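/- Smooth means $C^\infty$, and all coefficient functions below are smooth function germs at the origin. Two map-germs $f:(\mathbb R^2,p)\to\mathbb R^3$ and $g:(\mathbb R^2,q)\to\mathbb R^3$ are $\mathcal A$-equivalent if $\psi\circ f=g\circ\varphi$ near $p$ for some germs of diffeomorphisms $\varphi$ of the source with $\varphi(p)=q$ and $\psi$ of the target with $\psi(f(p))=g(q)$. A map has a cuspidal edge at a point if its germ there is $\mathcal A$-equivalent to $(u,v^2,v^3)$ at the origin; a cuspidal $S_k^\pm$ singularity if its germ is $\mathcal A$-equivalent to $(u,v^2,v^3(u^{k+1}\pm v^2))$ at the origin; a cuspidal cross cap is a cuspidal $S_0$ singularity. For a map $h$ from a neighbourhood of the origin in $\mathbb R^2$ to $\mathbb R^3$ let $S_2(h)$ be the set of its singular points (points where $dh$ is not injective) at which $h$ is not a cuspidal edge. Consider the normal form of a deformation of a cuspidal $S_1^\pm$ singularity, with deformation parameter $s$: $$f^s(u,v)=\bigl(u,\ u^2f_{21}(u)+v^2+us f_{24}(u,s),\ u^2f_{31}(u)+v^2f_{32}(u,v,s)+us f_{34}(u,s)\bigr),$$ $$f_{32}(u,v,s)=c_0(u,s)+v\,c_1(u,s)+v^2c_2(u,v^2,s)+v^3c_3(u,v^2,s),$$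 where $c_0(0,0)=0$, $c_1(0,s)=s$, and $f^0$ has a cuspidal $S_1^+$ or a cuspidal $S_1^-$ singularity at the origin. Write $$c_1(u,s)=s+us\,d_1(s)+u^2d_2(s)+u^3d_3(s)+u^4d_4(u,s)$$ with smooth germs $d_1,d_2,d_3,d_4$, and assume $d_2(0)=d_{20}^2>0$. **Theorem.** There are a smooth function germ $u:(\mathbb R,0)\to(\mathbb R,0)$, a neighbourhood $U$ of the origin in $\mathbb R^2$ and $\delta>0$ such that: 1. $S_2(f^s)\cap U=\emptyset$ for $0<s<\delta$, and $$S_2(f^{-\tilde s^2})\cap U=\{(u(\tilde s),0),(u(-\tilde s),0)\}\qquad\text{for } |\tilde s|<\delta.$$ In particular, every point of $S_2(f^s)$ near the origin, for small $s$, satisfies $v=0$, and such points exist only for $s=-\tilde s^2\le 0$. 2. As $\tilde s\to0$, $$u(\tilde s)=\frac{1}{d_{20}}\tilde s+\frac{1}{2d_{20}^4}\bigl(d_1(0)d_{20}^2-d_3(0)\bigr)\tilde s^2+\frac{1}{8d_{20}^7}\Bigl(\bigl(d_1(0)^2+4d_2'(0)\bigr)d_{20}^4-2\bigl(3d_1(0)d_3(0)+2d_4(0,0)\bigr)d_{20}^2+5d_3(0)^2\Bigr)\tilde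 s^3+O(\tilde s^4).$$ 3. For $0<|\tilde s|<\delta$ one has $u(\tilde s)\ne0$ and $u(\tilde s)\ne u(-\tilde s)$, and $f^{-\tilde s^2}$ has cuspidal cross caps at both points $(u(\pm\tilde s),0)$. -/

import Mathlib

open Filter Asymptotics
open scoped Topology ContDiff Manifold

/-- `f` is of class `C^∞` on some neighbourhood of `x`, i.e. it represents a smooth germ at `x`. -/
def SmoothNear {E F : Type*} [NormedAddCommGroup E] [NormedSpace ℝ E]
    [NormedAddCommGroup F] [NormedSpace ℝ F] (f : E → F) (x : E) : Prop :=
  ∀ᶠ y in 𝓝 x, ContDiffAt ℝ ∞ f y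

/-- The germ of `f` at `p` and the germ of `g` at `q` are `𝒜`-equivalent: there are germs of
diffeomorphisms `φ` of the source (taking `p` to `q`) and `ψ` of the target (taking `f p` to
`g q`) with `ψ ∘ f = g ∘ φ` near `p`. -/
def AEquivAt (f : ℝ × ℝ → ℝ × ℝ × ℝ) (p : ℝ × ℝ) (g : ℝ × ℝ → ℝ × ℝ × ℝ) (q : ℝ × ℝ) : Prop :=
  ∃ (φ : ℝ × ℝ → ℝ × ℝ) (ψ : ℝ × ℝ × ℝ → ℝ × ℝ × ℝ),
    IsLocalDiffeomorphAt 𝓘(ℝ, ℝ × ℝ) 𝓘(ℝ, ℝ × ℝ) ∞ φ p ∧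
    IsLocalDiffeomorphAt 𝓘(ℝ, ℝ × ℝ × ℝ) 𝓘(ℝ, ℝ × ℝ × ℝ) ∞ ψ (f p) ∧
    φ p = q ∧ ψ (f p) = g q ∧ ∀ᶠ x in 𝓝 p, ψ (f x) = g (φ x)

/-- `f` has a cuspidal edge at `p`: its germ is `𝒜`-equivalent to `(u, v², v³)` at the origin. -/
def IsCuspidalEdge (f : ℝ × ℝ → ℝ × ℝ × ℝ) (p : ℝ × ℝ) : Prop :=
  AEquivAt f p (fun x => (x.1, x.2 ^ 2, x.2 ^ 3)) 0

/-- `f` has a cuspidal `S_k` singularity with sign `ε` (`ε = 1` or `ε = -1`) at `p`: its germ is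
`𝒜`-equivalent to `(u, v², v³(u^{k+1} + ε v²))` at the origin. -/
def IsCuspidalS (k : ℕ) (ε : ℝ) (f : ℝ × ℝ → ℝ × ℝ × ℝ) (p : ℝ × ℝ) : Prop :=
  AEquivAt f p (fun x => (x.1, x.2 ^ 2, x.2 ^ 3 * (x.1 ^ (k + 1) + ε * x.2 ^ 2))) 0

/-- A cuspidal cross cap is a cuspidal `S_0` singularity (for `k = 0` the two signs give
`𝒜`-equivalent germs). -/
def IsCuspidalCrossCap (f : ℝ × ℝ → ℝ × ℝ × ℝ) (p : ℝ × ℝ) : Prop :=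
  IsCuspidalS 0 1 f p

/-- The set `S₂(f)` of the singular points of `f` (points where `df` is not injective) at which
`f` is not a cuspidal edge. -/
def nonEdgeSingularSet (f : ℝ × ℝ → ℝ × ℝ × ℝ) : Set (ℝ × ℝ) :=
  {p | ¬ Function.Injective (fderiv ℝ f p) ∧ ¬ IsCuspidalEdge f p}

/-- The coefficient functions of the normal form of a deformation of a cuspidal singularity, as
smooth germs at the origin in the variables `u`, `(u, s)` and `(u, w, s)` with `w = v²`, subject to
`c₀(0,0) = 0` and `c₁(0,s) = s`. -/
structure DeformationNormalForm where
  f21 : ℝ → ℝ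
  f31 : ℝ → ℝ
  f24 : ℝ × ℝ → ℝ
  f34 : ℝ × ℝ → ℝ
  c0 : ℝ × ℝ → ℝ
  c1 : ℝ × ℝ → ℝ
  c2 : ℝ × ℝ × ℝ → ℝ
  c3 : ℝ × ℝ × ℝ → ℝ
  smooth_f21 : SmoothNear f21 0
  smooth_f31 : SmoothNear f31 0
  smooth_f24 : SmoothNear f24 0
  smooth_f34 : SmoothNear f34 0
  smooth_c0 : SmoothNear c0 0
  smooth_c1 : SmoothNear c1 0
  smooth_c2 : SmoothNear c2 0
  smooth_c3 : SmoothNear c3 0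
  c0_origin : c0 (0, 0) = 0
  c1_axis : ∀ᶠ s in 𝓝 (0 : ℝ), c1 (0, s) = s

namespace DeformationNormalForm

/-- `f₃₂(u,v,s) = c₀(u,s) + v c₁(u,s) + v² c₂(u,v²,s) + v³ c₃(u,v²,s)`. -/
def f32 (N : DeformationNormalForm) (u v s : ℝ) : ℝ :=
  N.c0 (u, s) + v * N.c1 (u, s) + v ^ 2 * N.c2 (u, v ^ 2, s) + v ^ 3 * N.c3 (u, v ^ 2, s)

/-- The map `(u,v) ↦ f^s(u,v)` of the normal form at the deformation parameter `s`. -/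
def map (N : DeformationNormalForm) (s : ℝ) : ℝ × ℝ → ℝ × ℝ × ℝ := fun p =>
  (p.1,
   p.1 ^ 2 * N.f21 p.1 + p.2 ^ 2 + p.1 * s * N.f24 (p.1, s),
   p.1 ^ 2 * N.f31 p.1 + p.2 ^ 2 * N.f32 p.1 p.2 s + p.1 * s * N.f34 (p.1, s))

end DeformationNormalForm

/-!
Fix `s` and put `c₁ = c₁(·,s)`. The singular points of `f^s` near the origin are the points of the
axis `v = 0` (`foldedMap_not_injective_fderiv_iff`), and the type of the singularity at `(u₀,0)` is
read off from `c₁` at `u₀`: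

* The even part in `v` of the last component of `f^s` is a function of the first two components, so
  a shear of the target turns `f^s` into `(u, v², v³ h(u,v²))` with `h(u,w) = c₁(u) + w c₃(u,w)`.
* If `c₁(u₀) ≠ 0`, dividing the last component by the unit `h` gives a cuspidal edge
  (`foldedMap_isCuspidalEdge`).
* If `c₁(u₀) = 0` and `c₁'(u₀) ≠ 0`, then `h(u,w) - w` can replace the coordinate `u`, which gives
  `(u, v², v³(u + v²))`, a cuspidal cross cap (`foldedMap_isCuspidalCrossCap`).
* If `c₁(u₀) = 0`, then `v ↦ f^s(u₀,v)` is even up to `O(v⁵)`. This survives target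
  diffeomorphisms, whereas along any curve through the origin with non-zero velocity one of the
  components of `(u, v², v³)` has a non-zero odd part of order one or three. So there is no
  cuspidal edge (`foldedMap_not_isCuspidalEdge`).

Hence `S₂(f^s)` is the zero set of `c₁(·,s)` on the axis. Completing the square,
`c₁(x,-t²) = E (F(x,t)² - t²)` with a unit `E` and `F(x,t) = d₂₀ x + …` even in `t`
(`coeffExpansion_factorization`). The inverse function theorem solves `F(x,t) = t` by a smooth germ
`x = u(t)`, the zeros are `u(t)` and `u(-t)`, and they are simple for `t ≠ 0`
(`exists_coeffExpansion_root_germ`). For `s > 0` the same factorization shows `c₁(x,s) > 0`.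

The distance from `u` to an approximate solution `P` is bounded by the residual `F(P(t),t) - t`
(`exists_solution_germ`). For the cubic `P` of the theorem `c₁(P(t),-t²) = O(t⁵)`
(`coeffExpansion_cubic_isBigO`), and `F(P(t),t) + t` vanishes to first order only, so the residual
is `O(t⁴)`.
-/

/-! ### Smooth germs and local diffeomorphisms -/

section SmoothNear

variable {E F G : Type*} [NormedAddCommGroup E] [NormedSpace ℝ E]
  [NormedAddCommGroup F] [NormedSpace ℝ F] [NormedAddCommGroup G] [NormedSpace ℝ G]

theorem ContDiff.smoothNear {f : E → F} (hf : ContDiff ℝ ∞ f) (x : E) : SmoothNear f x :=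
  Eventually.of_forall fun _ => hf.contDiffAt

theorem SmoothNear.contDiffAt {f : E → F} {x : E} (hf : SmoothNear f x) : ContDiffAt ℝ ∞ f x :=
  Eventually.self_of_nhds hf

theorem SmoothNear.continuousAt {f : E → F} {x : E} (hf : SmoothNear f x) : ContinuousAt f x :=
  hf.contDiffAt.continuousAt

theorem SmoothNear.differentiableAt {f : E → F} {x : E} (hf : SmoothNear f x) :
    DifferentiableAt ℝ f x :=
  hf.contDiffAt.differentiableAt (by simp)

theorem SmoothNear.eventually {f : E → F} {x : E} (hf : SmoothNear f x) :
    ∀ᶠ y in 𝓝 x, SmoothNear f y :=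
  eventually_eventually_nhds.2 hf

theorem SmoothNear.comp {g : F → G} {f : E → F} {x : E} (hg : SmoothNear g (f x))
    (hf : SmoothNear f x) : SmoothNear (fun y => g (f y)) x := by
  filter_upwards [hf, hf.continuousAt.eventually hg] with y h1 h2
  exact ContDiffAt.comp y h2 h1

theorem SmoothNear.prodMk {f : E → F} {g : E → G} {x : E} (hf : SmoothNear f x)
    (hg : SmoothNear g x) : SmoothNear (fun y => (f y, g y)) x := by
  filter_upwards [hf, hg] with y h1 h2
  exact ContDiffAt.prodMk h1 h2

theorem SmoothNear.add {f g : E → F} {x : E} (hf : SmoothNear f x)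
    (hg : SmoothNear g x) : SmoothNear (fun y => f y + g y) x := by
  filter_upwards [hf, hg] with y h1 h2
  exact ContDiffAt.add h1 h2

theorem SmoothNear.sub {f g : E → F} {x : E} (hf : SmoothNear f x)
    (hg : SmoothNear g x) : SmoothNear (fun y => f y - g y) x := by
  filter_upwards [hf, hg] with y h1 h2
  exact ContDiffAt.sub h1 h2

theorem SmoothNear.mul {f g : E → ℝ} {x : E} (hf : SmoothNear f x)
    (hg : SmoothNear g x) : SmoothNear (fun y => f y * g y) x := by
  filter_upwards [hf, hg] with y h1 h2
  exact ContDiffAt.mul h1 h2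

theorem SmoothNear.inv {f : E → ℝ} {x : E} (hf : SmoothNear f x) (h : f x ≠ 0) :
    SmoothNear (fun y => (f y)⁻¹) x := by
  filter_upwards [hf, hf.continuousAt.eventually_ne h] with y h1 h2
  exact ContDiffAt.inv h1 h2

theorem SmoothNear.sqrt {f : E → ℝ} {x : E} (hf : SmoothNear f x) (h : f x ≠ 0) :
    SmoothNear (fun y => √(f y)) x := by
  filter_upwards [hf, hf.continuousAt.eventually_ne h] with y h1 h2
  exact ContDiffAt.sqrt h1 h2

theorem SmoothNear.sub_linear_isBigO {f : ℝ → ℝ} (hf : SmoothNear f 0) :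
    (fun s : ℝ => f s - f 0 - s * deriv f 0) =O[𝓝 0] fun s => s ^ 2 := by
  have hd : DifferentiableAt ℝ (deriv f) 0 := by
    have h1 : DifferentiableAt ℝ (fderiv ℝ f) 0 :=
      (hf.contDiffAt.fderiv_right (m := ∞) (by simp)).differentiableAt (by simp)
    exact h1.clm_apply (differentiableAt_const (1 : ℝ))
  obtain ⟨C, hC0, hC⟩ := hd.isBigO_sub.exists_pos
  rw [IsBigOWith] at hC
  obtain ⟨r, hr, hball⟩ := Metric.eventually_nhds_iff_ball.1 (hC.and hf)
  refine IsBigO.of_bound C ?_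
  filter_upwards [Metric.ball_mem_nhds (0 : ℝ) hr] with s hs
  have hsr : |s| < r := by simpa using hs
  have hsub : ∀ y ∈ Metric.closedBall (0 : ℝ) |s|, y ∈ Metric.ball (0 : ℝ) r := fun y hy =>
    Metric.closedBall_subset_ball hsr hy
  -- the derivative of the remainder is at most `C |s|` between `0` and `s`
  have hmv := (convex_closedBall (0 : ℝ) |s|).norm_image_sub_le_of_norm_hasDerivWithin_le
    (f := fun y => f y - f 0 - y * deriv f 0) (f' := fun y => deriv f y - deriv f 0)
    (C := C * |s|) (x := 0) (y := s)
    (fun y hy => by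
      have h1 := ((hball y (hsub y hy)).2.differentiableAt (by simp)).hasDerivAt
      have h2 := (h1.sub_const (f 0)).sub ((hasDerivAt_id y).mul_const (deriv f 0))
      rw [one_mul] at h2
      exact h2.hasDerivWithinAt)
    (fun y hy => by
      have h1 := (hball y (hsub y hy)).1
      have h2 : |y| ≤ |s| := by simpa using hy
      rw [sub_zero] at h1
      exact h1.trans (mul_le_mul_of_nonneg_left h2 hC0.le))
    (by simp) (by simp)
  simp only [sub_self, zero_mul, sub_zero, Real.norm_eq_abs] at hmv
  rw [norm_pow, Real.norm_eq_abs, Real.norm_eq_abs]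
  linarith

/-- The inverse function theorem for smooth germs. -/
theorem SmoothNear.isLocalDiffeomorphAt [CompleteSpace E] {f : E → F} {x : E}
    (hf : SmoothNear f x) {e : E ≃L[ℝ] F} (he : HasFDerivAt f (e : E →L[ℝ] F) x) :
    IsLocalDiffeomorphAt 𝓘(ℝ, E) 𝓘(ℝ, F) ∞ f x := by
  -- invertibility of the derivative is an open condition, so the local inverse is smooth near `f x`
  have hinv : ∀ᶠ y in 𝓝 x, ∃ e' : E ≃L[ℝ] F, HasFDerivAt f (e' : E →L[ℝ] F) y := by
    have h1 : ContinuousAt (fderiv ℝ f) x := by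
      exact (hf.contDiffAt.fderiv_right (m := 0) (by simp)).continuousAt
    have h2 : Set.range ((↑) : (E ≃L[ℝ] F) → E →L[ℝ] F) ∈ 𝓝 (fderiv ℝ f x) := by
      rw [he.fderiv]
      exact ContinuousLinearEquiv.nhds e
    filter_upwards [h1 h2, hf] with y hy hfy
    obtain ⟨e', he'⟩ := hy
    exact ⟨e', he' ▸ (hfy.differentiableAt (by simp)).hasFDerivAt⟩
  obtain ⟨V, hV, hVo, hxV⟩ := eventually_nhds_iff.1 (hf.and hinv)
  let e₀ := hf.contDiffAt.toOpenPartialHomeomorph f he (by simp)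
  let e₁ := e₀.restrOpen V hVo
  have hcoe : ∀ y, e₁ y = f y := fun y => rfl
  refine ⟨⟨e₁.toPartialEquiv, e₁.open_source, e₁.open_target, ?_, ?_⟩, ?_, ?_⟩
  · rw [contMDiffOn_iff_contDiffOn]
    intro y hy
    exact ((hV y hy.2).1).contDiffWithinAt
  · rw [contMDiffOn_iff_contDiffOn]
    intro z hz
    have hy : e₁.symm z ∈ e₁.source := e₁.map_target hz
    obtain ⟨e', he'⟩ := (hV _ hy.2).2
    exact (e₁.contDiffAt_symm hz (f₀' := e') he' (hV _ hy.2).1).contDiffWithinAt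
  · exact ⟨hf.contDiffAt.mem_toOpenPartialHomeomorph_source he (by simp), hxV⟩
  · intro y _
    rfl

theorem SmoothNear.isLocalDiffeomorphAt_of_injective [FiniteDimensional ℝ E] {f : E → E}
    {x : E} (hf : SmoothNear f x) (h : ∀ w, fderiv ℝ f x w = 0 → w = 0) :
    IsLocalDiffeomorphAt 𝓘(ℝ, E) 𝓘(ℝ, E) ∞ f x := by
  have : CompleteSpace E := FiniteDimensional.complete ℝ E
  let e := (LinearEquiv.ofInjectiveEndo (fderiv ℝ f x : E →ₗ[ℝ] E)
    ((injective_iff_map_eq_zero _).2 h)).toContinuousLinearEquiv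
  refine hf.isLocalDiffeomorphAt (e := e) ?_
  have h1 : (e : E →L[ℝ] E) = fderiv ℝ f x := by
    ext w
    rfl
  rw [h1]
  exact hf.differentiableAt.hasFDerivAt

theorem IsLocalDiffeomorphAt.contDiffAt {f : E → F} {x : E}
    (hf : IsLocalDiffeomorphAt 𝓘(ℝ, E) 𝓘(ℝ, F) ∞ f x) : ContDiffAt ℝ ∞ f x :=
  contMDiffAt_iff_contDiffAt.1 hf.contMDiffAt

theorem IsLocalDiffeomorphAt.fderiv_injective {f : E → F} {x : E}
    (hf : IsLocalDiffeomorphAt 𝓘(ℝ, E) 𝓘(ℝ, F) ∞ f x) :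
    Function.Injective (fderiv ℝ f x) := by
  have h := (hf.mfderivToContinuousLinearEquiv (by simp)).injective
  have h2 := hf.mfderivToContinuousLinearEquiv_coe (by simp)
  rw [mfderiv_eq_fderiv] at h2
  rw [← h2]
  exact h

end SmoothNear

theorem AEquivAt.of_target_diffeo {f g : ℝ × ℝ → ℝ × ℝ × ℝ} {p q : ℝ × ℝ}
    {ψ : ℝ × ℝ × ℝ → ℝ × ℝ × ℝ}
    (hψ : IsLocalDiffeomorphAt 𝓘(ℝ, ℝ × ℝ × ℝ) 𝓘(ℝ, ℝ × ℝ × ℝ) ∞ ψ (f p))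
    (h : AEquivAt (fun x => ψ (f x)) p g q) : AEquivAt f p g q := by
  obtain ⟨φ, χ, hφ, hχ, h1, h2, h3⟩ := h
  exact ⟨φ, χ ∘ ψ, hφ, IsLocalDiffeomorphAt.comp (hf := hψ) (hg := hχ), h1, h2, h3⟩

/-! ### The recognition criterion for a single map -/

theorem isLocalDiffeomorphAt_shear {a : ℝ → ℝ} {n : ℝ × ℝ → ℝ} {x : ℝ × ℝ × ℝ}
    (ha : SmoothNear a x.1) (hn : SmoothNear n (x.1, x.2.1)) :
    IsLocalDiffeomorphAt 𝓘(ℝ, ℝ × ℝ × ℝ) 𝓘(ℝ, ℝ × ℝ × ℝ) ∞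
      (fun y : ℝ × ℝ × ℝ => (y.1, y.2.1 - a y.1, y.2.2 - n (y.1, y.2.1))) x := by
  have s1 : SmoothNear (fun y : ℝ × ℝ × ℝ => y.1) x := contDiff_fst.smoothNear x
  have s2 : SmoothNear (fun y : ℝ × ℝ × ℝ => y.2.1) x :=
    (contDiff_fst.comp contDiff_snd).smoothNear x
  have s3 : SmoothNear (fun y : ℝ × ℝ × ℝ => y.2.2) x :=
    (contDiff_snd.comp contDiff_snd).smoothNear x
  refine SmoothNear.isLocalDiffeomorphAt_of_injective
    (s1.prodMk ((s2.sub (SmoothNear.comp (f := fun y : ℝ × ℝ × ℝ => y.1) ha s1)).prodMk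
      (s3.sub (SmoothNear.comp (f := fun y : ℝ × ℝ × ℝ => (y.1, y.2.1)) hn (s1.prodMk s2))))) ?_
  have p1 : HasFDerivAt (fun y : ℝ × ℝ × ℝ => y.1) (ContinuousLinearMap.fst ℝ ℝ (ℝ × ℝ)) x :=
    hasFDerivAt_fst
  have p2 : HasFDerivAt (fun y : ℝ × ℝ × ℝ => y.2) (ContinuousLinearMap.snd ℝ ℝ (ℝ × ℝ)) x :=
    hasFDerivAt_snd
  have h := p1.prodMk ((p2.fst.sub
    (HasFDerivAt.comp x ha.differentiableAt.hasFDerivAt p1)).prodMk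
    (p2.snd.sub (HasFDerivAt.comp x (f := fun y : ℝ × ℝ × ℝ => (y.1, y.2.1))
      hn.differentiableAt.hasFDerivAt (p1.prodMk p2.fst))))
  rintro ⟨w1, w2, w3⟩ hw
  have hw' := (DFunLike.congr_fun h.fderiv (w1, w2, w3)).symm.trans hw
  simp only [ContinuousLinearMap.prod_apply, sub_apply, ContinuousLinearMap.comp_apply,
    ContinuousLinearMap.coe_fst', ContinuousLinearMap.coe_snd', Prod.mk_eq_zero] at hw'
  obtain ⟨rfl, h2, h3⟩ := hw'
  have h2' : w2 = 0 := by simpa using h2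
  subst h2'
  rw [Prod.mk_zero_zero, map_zero] at h3
  simpa using h3

/-- Target change that moves the coefficient `k` into the first coordinate and rescales the
last one. -/
theorem isLocalDiffeomorphAt_straighten {k m : ℝ × ℝ → ℝ} {x : ℝ × ℝ × ℝ}
    (hk : SmoothNear k (x.1, x.2.1)) (hm : SmoothNear m (x.1, x.2.1))
    (hk' : fderiv ℝ k (x.1, x.2.1) (1, 0) ≠ 0) (hm' : m (x.1, x.2.1) ≠ 0) :
    IsLocalDiffeomorphAt 𝓘(ℝ, ℝ × ℝ × ℝ) 𝓘(ℝ, ℝ × ℝ × ℝ) ∞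
      (fun y : ℝ × ℝ × ℝ => (k (y.1, y.2.1), y.2.1, y.2.2 * m (y.1, y.2.1))) x := by
  have s1 : SmoothNear (fun y : ℝ × ℝ × ℝ => y.1) x := contDiff_fst.smoothNear x
  have s2 : SmoothNear (fun y : ℝ × ℝ × ℝ => y.2.1) x :=
    (contDiff_fst.comp contDiff_snd).smoothNear x
  have s3 : SmoothNear (fun y : ℝ × ℝ × ℝ => y.2.2) x :=
    (contDiff_snd.comp contDiff_snd).smoothNear x
  have s12 := s1.prodMk s2
  refine SmoothNear.isLocalDiffeomorphAt_of_injective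
    ((SmoothNear.comp (f := fun y : ℝ × ℝ × ℝ => (y.1, y.2.1)) hk s12).prodMk (s2.prodMk
      (s3.mul (SmoothNear.comp (f := fun y : ℝ × ℝ × ℝ => (y.1, y.2.1)) hm s12)))) ?_
  have p1 : HasFDerivAt (fun y : ℝ × ℝ × ℝ => y.1) (ContinuousLinearMap.fst ℝ ℝ (ℝ × ℝ)) x :=
    hasFDerivAt_fst
  have p2 : HasFDerivAt (fun y : ℝ × ℝ × ℝ => y.2) (ContinuousLinearMap.snd ℝ ℝ (ℝ × ℝ)) x :=
    hasFDerivAt_snd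
  have h := (HasFDerivAt.comp x (f := fun y : ℝ × ℝ × ℝ => (y.1, y.2.1))
      hk.differentiableAt.hasFDerivAt (p1.prodMk p2.fst)).prodMk (p2.fst.prodMk
    (p2.snd.mul (HasFDerivAt.comp x (f := fun y : ℝ × ℝ × ℝ => (y.1, y.2.1))
      hm.differentiableAt.hasFDerivAt (p1.prodMk p2.fst))))
  rintro ⟨w1, w2, w3⟩ hw
  have hw' := (DFunLike.congr_fun h.fderiv (w1, w2, w3)).symm.trans hw
  simp only [ContinuousLinearMap.prod_apply, add_apply, ContinuousLinearMap.comp_apply,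
    ContinuousLinearMap.coe_fst', ContinuousLinearMap.coe_snd', Prod.mk_eq_zero,
    smul_apply, smul_eq_mul] at hw'
  obtain ⟨h1, rfl, h3⟩ := hw'
  have hlin : ((w1, 0) : ℝ × ℝ) = w1 • ((1, 0) : ℝ × ℝ) := by simp
  have h1' : w1 = 0 := by
    rw [hlin, map_smul, smul_eq_mul] at h1
    exact (mul_eq_zero.1 h1).resolve_right hk'
  subst h1'
  rw [Prod.mk_zero_zero, map_zero] at h3
  have h4 : w3 = 0 := by simpa [hm'] using h3
  simp [h4]

/-- Source change accompanying `isLocalDiffeomorphAt_straighten`. -/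
theorem isLocalDiffeomorphAt_straighten_source {k : ℝ × ℝ → ℝ} {u₀ : ℝ}
    (hk : SmoothNear k (u₀, 0)) (hk' : fderiv ℝ k (u₀, 0) (1, 0) ≠ 0) :
    IsLocalDiffeomorphAt 𝓘(ℝ, ℝ × ℝ) 𝓘(ℝ, ℝ × ℝ) ∞
      (fun y : ℝ × ℝ => (k (y.1, y.2 ^ 2), y.2)) (u₀, 0) := by
  have hk0 : SmoothNear k (((u₀, 0) : ℝ × ℝ).1, ((u₀, 0) : ℝ × ℝ).2 ^ 2) := by simpa using hk
  have hin : ContDiff ℝ ∞ (fun y : ℝ × ℝ => (y.1, y.2 ^ 2)) := by fun_prop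
  refine SmoothNear.isLocalDiffeomorphAt_of_injective
    ((SmoothNear.comp (f := fun y : ℝ × ℝ => (y.1, y.2 ^ 2)) hk0 (hin.smoothNear _)).prodMk
      (contDiff_snd.smoothNear _)) ?_
  have p1 : HasFDerivAt (fun y : ℝ × ℝ => y.1) (ContinuousLinearMap.fst ℝ ℝ ℝ) (u₀, (0 : ℝ)) :=
    hasFDerivAt_fst
  have p2 : HasFDerivAt (fun y : ℝ × ℝ => y.2) (ContinuousLinearMap.snd ℝ ℝ ℝ) (u₀, (0 : ℝ)) :=
    hasFDerivAt_snd
  have h := (HasFDerivAt.comp (u₀, (0 : ℝ)) (f := fun y : ℝ × ℝ => (y.1, y.2 ^ 2))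
      hk0.differentiableAt.hasFDerivAt (p1.prodMk (p2.pow 2))).prodMk p2
  rintro ⟨w1, w2⟩ hw
  have hw' := (DFunLike.congr_fun h.fderiv (w1, w2)).symm.trans hw
  simp only [ContinuousLinearMap.prod_apply, ContinuousLinearMap.comp_apply,
    ContinuousLinearMap.coe_fst', ContinuousLinearMap.coe_snd', Prod.mk_eq_zero,
    smul_apply, smul_eq_mul] at hw'
  obtain ⟨h1, rfl⟩ := hw'
  have hlin : ((w1, 0) : ℝ × ℝ) = w1 • ((1, 0) : ℝ × ℝ) := by simp
  have h1' : w1 = 0 := by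
    simp only [mul_zero, hlin, map_smul, smul_eq_mul] at h1
    refine (mul_eq_zero.1 h1).resolve_right ?_
    simpa using hk'
  simp [h1']

/-- The germ `(u, v², v³ h(u,v²))` becomes `(u, v², v³ r(u,v²))` whenever `m h = r(k, w)` for a
unit `m` and a function `k` that can replace the coordinate `u`. -/
theorem aEquivAt_of_mul_eq {h k m r : ℝ × ℝ → ℝ} {u₀ : ℝ}
    (hk : SmoothNear k (u₀, 0)) (hm : SmoothNear m (u₀, 0))
    (hk' : fderiv ℝ k (u₀, 0) (1, 0) ≠ 0) (hk0 : k (u₀, 0) = 0) (hm' : m (u₀, 0) ≠ 0)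
    (hr : ∀ᶠ y in 𝓝 (u₀, (0 : ℝ)), h y * m y = r (k y, y.2)) :
    AEquivAt (fun x => (x.1, x.2 ^ 2, x.2 ^ 3 * h (x.1, x.2 ^ 2))) (u₀, 0)
      (fun x => (x.1, x.2 ^ 2, x.2 ^ 3 * r (x.1, x.2 ^ 2))) 0 := by
  refine ⟨fun y => (k (y.1, y.2 ^ 2), y.2),
    fun y => (k (y.1, y.2.1), y.2.1, y.2.2 * m (y.1, y.2.1)),
    isLocalDiffeomorphAt_straighten_source hk hk', ?_, ?_, ?_, ?_⟩
  · apply isLocalDiffeomorphAt_straighten <;> simpa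
  · simp [hk0]
  · simp [hk0]
  · have ht : Tendsto (fun x : ℝ × ℝ => (x.1, x.2 ^ 2)) (𝓝 (u₀, (0 : ℝ))) (𝓝 (u₀, (0 : ℝ))) := by
      have : ContinuousAt (fun x : ℝ × ℝ => (x.1, x.2 ^ 2)) (u₀, (0 : ℝ)) := by fun_prop
      simpa [ContinuousAt] using this
    filter_upwards [ht.eventually hr] with x hx
    rw [mul_assoc, hx]

/-- A map `(u, a + v², b + v²(c₀ + v c₁ + v² c₂ + v³ c₃))`, with `a`, `b`, `c₀`, `c₁` functions
of `u` and `c₂`, `c₃` functions of `(u, v²)`. -/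
def foldedMap (a b c0 c1 : ℝ → ℝ) (c2 c3 : ℝ × ℝ → ℝ) : ℝ × ℝ → ℝ × ℝ × ℝ := fun p =>
  (p.1, a p.1 + p.2 ^ 2,
    b p.1 + p.2 ^ 2 * (c0 p.1 + p.2 * c1 p.1 + p.2 ^ 2 * c2 (p.1, p.2 ^ 2)
      + p.2 ^ 3 * c3 (p.1, p.2 ^ 2)))

section foldedMap

variable {a b c0 c1 : ℝ → ℝ} {c2 c3 : ℝ × ℝ → ℝ} {u₀ : ℝ}

/-- The even part of the last component is a function of the first two components, so a shear
of the target removes it. -/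
theorem foldedMap_aEquivAt_of_odd {g : ℝ × ℝ → ℝ × ℝ × ℝ} {q : ℝ × ℝ}
    (ha : SmoothNear a u₀) (hb : SmoothNear b u₀)
    (h0 : SmoothNear c0 u₀) (h2 : SmoothNear c2 (u₀, 0))
    (h : AEquivAt (fun x => (x.1, x.2 ^ 2,
      x.2 ^ 3 * (c1 x.1 + x.2 ^ 2 * c3 (x.1, x.2 ^ 2)))) (u₀, 0) g q) :
    AEquivAt (foldedMap a b c0 c1 c2 c3) (u₀, 0) g q := by
  have s1 : SmoothNear (fun y : ℝ × ℝ => y.1) (u₀, a u₀) := contDiff_fst.smoothNear _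
  have s2 : SmoothNear (fun y : ℝ × ℝ => y.2) (u₀, a u₀) := contDiff_snd.smoothNear _
  have sa : SmoothNear (fun y : ℝ × ℝ => a y.1) (u₀, a u₀) :=
    SmoothNear.comp (f := fun y : ℝ × ℝ => y.1) ha s1
  have sb : SmoothNear (fun y : ℝ × ℝ => b y.1) (u₀, a u₀) :=
    SmoothNear.comp (f := fun y : ℝ × ℝ => y.1) hb s1
  have s0 : SmoothNear (fun y : ℝ × ℝ => c0 y.1) (u₀, a u₀) :=
    SmoothNear.comp (f := fun y : ℝ × ℝ => y.1) h0 s1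
  have sw := s2.sub sa
  have s4 : SmoothNear (fun y : ℝ × ℝ => c2 (y.1, y.2 - a y.1)) (u₀, a u₀) :=
    SmoothNear.comp (f := fun y : ℝ × ℝ => (y.1, y.2 - a y.1)) (by simpa using h2)
      (s1.prodMk sw)
  have hn := (sb.add (sw.mul s0)).add ((sw.mul sw).mul s4)
  refine AEquivAt.of_target_diffeo (isLocalDiffeomorphAt_shear (a := a)
    (n := fun y => b y.1 + (y.2 - a y.1) * c0 y.1
      + (y.2 - a y.1) * (y.2 - a y.1) * c2 (y.1, y.2 - a y.1))
    (by simpa [foldedMap] using ha) (by simpa [foldedMap] using hn)) ?_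
  convert h using 2 with x
  simp only [foldedMap, add_sub_cancel_left, Prod.mk.injEq, true_and]
  ring

theorem SmoothNear.smoothNear_odd_coeff (h1 : SmoothNear c1 u₀) (h3 : SmoothNear c3 (u₀, 0)) :
    SmoothNear (fun y : ℝ × ℝ => c1 y.1 + y.2 * c3 y) (u₀, 0) :=
  (SmoothNear.comp (f := fun y : ℝ × ℝ => y.1) h1 (contDiff_fst.smoothNear _)).add
    ((contDiff_snd.smoothNear _).mul h3)

theorem foldedMap_isCuspidalEdge
    (ha : SmoothNear a u₀) (hb : SmoothNear b u₀) (h0 : SmoothNear c0 u₀)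
    (h1 : SmoothNear c1 u₀) (h2 : SmoothNear c2 (u₀, 0)) (h3 : SmoothNear c3 (u₀, 0))
    (hne : c1 u₀ ≠ 0) :
    IsCuspidalEdge (foldedMap a b c0 c1 c2 c3) (u₀, 0) := by
  have hh := h1.smoothNear_odd_coeff h3
  have hne' : c1 ((u₀, (0 : ℝ)) : ℝ × ℝ).1 + ((u₀, (0 : ℝ)) : ℝ × ℝ).2 * c3 (u₀, 0) ≠ 0 := by
    simpa using hne
  refine foldedMap_aEquivAt_of_odd ha hb h0 h2 ?_
  have hk : ContDiff ℝ ∞ (fun y : ℝ × ℝ => y.1 - u₀) := by fun_prop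
  have key := aEquivAt_of_mul_eq (h := fun y => c1 y.1 + y.2 * c3 y) (r := fun _ => 1)
    (hk.smoothNear (u₀, 0)) (hh.inv hne')
    (by
      have : HasFDerivAt (fun y : ℝ × ℝ => y.1 - u₀) (ContinuousLinearMap.fst ℝ ℝ ℝ)
        (u₀, (0 : ℝ)) := hasFDerivAt_fst.sub_const u₀
      rw [this.fderiv]
      simp)
    (by simp) (inv_ne_zero hne')
    (by
      filter_upwards [hh.continuousAt.eventually_ne hne'] with y hy
      exact mul_inv_cancel₀ hy)
  simpa using key

theorem foldedMap_isCuspidalCrossCap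
    (ha : SmoothNear a u₀) (hb : SmoothNear b u₀) (h0 : SmoothNear c0 u₀)
    (h1 : SmoothNear c1 u₀) (h2 : SmoothNear c2 (u₀, 0)) (h3 : SmoothNear c3 (u₀, 0))
    (hz : c1 u₀ = 0) (hd : deriv c1 u₀ ≠ 0) :
    IsCuspidalCrossCap (foldedMap a b c0 c1 c2 c3) (u₀, 0) := by
  have hh := h1.smoothNear_odd_coeff h3
  unfold IsCuspidalCrossCap IsCuspidalS
  refine foldedMap_aEquivAt_of_odd ha hb h0 h2 ?_
  have s2 : SmoothNear (fun y : ℝ × ℝ => y.2) (u₀, 0) := contDiff_snd.smoothNear _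
  have hk := hh.sub s2
  have hone : SmoothNear (fun _ : ℝ × ℝ => (1 : ℝ)) (u₀, 0) := contDiff_const.smoothNear _
  have key := aEquivAt_of_mul_eq (h := fun y => c1 y.1 + y.2 * c3 y)
    (r := fun y => y.1 + y.2) hk hone
    (by
      -- the derivative in the direction `u` is computed along the axis `w = 0`
      have e1 : HasDerivAt (fun x : ℝ => ((x, 0) : ℝ × ℝ)) ((1, 0) : ℝ × ℝ) u₀ :=
        (hasDerivAt_id u₀).prodMk (hasDerivAt_const u₀ 0)
      have e2 := HasFDerivAt.comp_hasDerivAt u₀ (f := fun x : ℝ => ((x, 0) : ℝ × ℝ))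
        hk.differentiableAt.hasFDerivAt e1
      rw [← e2.deriv]
      simpa [Function.comp_def] using hd)
    (by simp [hz]) one_ne_zero (by simp)
  simpa using key

/-- If `c₁(u₀) = 0`, then `v ↦ f(u₀, v)` is even up to `O(v⁵)`, and so is its image under a target
diffeomorphism `ψ`. Were `ψ ∘ f = (φ₁, φ₂², φ₂³)`, the odd parts of `φ₁` and of `φ₂³` would be
`O(v⁵)`, which forces `∂φ/∂v = 0` at the point. -/
theorem foldedMap_not_isCuspidalEdge
    (h2 : SmoothNear c2 (u₀, 0)) (h3 : SmoothNear c3 (u₀, 0))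
    (hz : c1 u₀ = 0) :
    ¬ IsCuspidalEdge (foldedMap a b c0 c1 c2 c3) (u₀, 0) := by
  rintro ⟨φ, ψ, hφ, hψ, hφ0, -, hev⟩
  set f := foldedMap a b c0 c1 c2 c3 with hf
  have hline : Tendsto (fun v : ℝ => (u₀, v)) (𝓝 0) (𝓝 (u₀, (0 : ℝ))) :=
    Continuous.tendsto (by fun_prop) 0
  have hneg : Tendsto (fun v : ℝ => -v) (𝓝 0) (𝓝 0) := by
    simpa using (continuous_neg.tendsto (0 : ℝ))
  have hc2 : Tendsto (fun v : ℝ => c2 (u₀, v ^ 2)) (𝓝 0) (𝓝 (c2 (u₀, 0))) := by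
    refine h2.continuousAt.tendsto.comp ?_
    simpa using (Continuous.tendsto (by fun_prop : Continuous fun v : ℝ => (u₀, v ^ 2)) 0)
  have hc3 : Tendsto (fun v : ℝ => c3 (u₀, v ^ 2)) (𝓝 0) (𝓝 (c3 (u₀, 0))) := by
    refine h3.continuousAt.tendsto.comp ?_
    simpa using (Continuous.tendsto (by fun_prop : Continuous fun v : ℝ => (u₀, v ^ 2)) 0)
  have hft : Tendsto (fun v : ℝ => f (u₀, v)) (𝓝 0) (𝓝 (f (u₀, 0))) := by
    have hv : Tendsto (fun v : ℝ => v) (𝓝 0) (𝓝 0) := tendsto_id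
    exact tendsto_const_nhds.prodMk_nhds ((tendsto_const_nhds.add (hv.pow 2)).prodMk_nhds
      (tendsto_const_nhds.add ((hv.pow 2).mul (((tendsto_const_nhds.add
        (hv.mul tendsto_const_nhds)).add ((hv.pow 2).mul (by simpa using hc2))).add
          ((hv.pow 3).mul (by simpa using hc3))))))
  have hodd : (fun v : ℝ => f (u₀, v) - f (u₀, -v)) =O[𝓝 0] fun v => v ^ 5 := by
    have e : (fun v : ℝ => f (u₀, v) - f (u₀, -v)) =
        fun v => ((0 : ℝ), (0 : ℝ), v ^ 5 * (2 * c3 (u₀, v ^ 2))) := by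
      funext v
      simp only [hf, foldedMap, hz, Prod.mk_sub_mk, Prod.mk.injEq, sub_self, true_and]
      refine ⟨by ring, ?_⟩
      rw [neg_sq]
      ring
    rw [e]
    refine IsBigO.prod_left (isBigO_zero _ _) (IsBigO.prod_left (isBigO_zero _ _) ?_)
    simpa using (isBigO_refl (fun v : ℝ => v ^ 5) (𝓝 0)).mul
      ((hc3.const_mul 2).isBigO_one ℝ)
  have hψf : (fun v : ℝ => ψ (f (u₀, v)) - ψ (f (u₀, -v))) =O[𝓝 0] fun v => v ^ 5 :=
    ((hψ.contDiffAt.hasStrictFDerivAt (by simp)).isBigO_sub.comp_tendsto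
      (hft.prodMk_nhds (hft.comp hneg))).trans hodd
  have hg : (fun v : ℝ => (((φ (u₀, v)).1, (φ (u₀, v)).2 ^ 2, (φ (u₀, v)).2 ^ 3) : ℝ × ℝ × ℝ)
      - ((φ (u₀, -v)).1, (φ (u₀, -v)).2 ^ 2, (φ (u₀, -v)).2 ^ 3)) =O[𝓝 0] fun v => v ^ 5 := by
    refine hψf.congr' ?_ EventuallyEq.rfl
    filter_upwards [hline.eventually hev, (hline.comp hneg).eventually hev] with v hv1 hv2
    rw [hv1]
    exact congrArg _ hv2
  have hg1 : (fun v : ℝ => (φ (u₀, v)).1 - (φ (u₀, -v)).1) =O[𝓝 0] fun v => v ^ 5 :=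
    (isBigO_fst_prod (f' := fun v : ℝ => (φ (u₀, v)).1 - (φ (u₀, -v)).1)
      (g' := fun v : ℝ => (((φ (u₀, v)).2 ^ 2, (φ (u₀, v)).2 ^ 3) : ℝ × ℝ)
        - ((φ (u₀, -v)).2 ^ 2, (φ (u₀, -v)).2 ^ 3))).trans hg
  have hg3 : (fun v : ℝ => (φ (u₀, v)).2 ^ 3 - (φ (u₀, -v)).2 ^ 3) =O[𝓝 0] fun v => v ^ 5 :=
    ((isBigO_snd_prod (f' := fun v : ℝ => (φ (u₀, v)).2 ^ 2 - (φ (u₀, -v)).2 ^ 2)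
      (g' := fun v : ℝ => (φ (u₀, v)).2 ^ 3 - (φ (u₀, -v)).2 ^ 3)).trans
      (isBigO_snd_prod (f' := fun v : ℝ => (φ (u₀, v)).1 - (φ (u₀, -v)).1)
        (g' := fun v : ℝ => (((φ (u₀, v)).2 ^ 2, (φ (u₀, v)).2 ^ 3) : ℝ × ℝ)
        - ((φ (u₀, -v)).2 ^ 2, (φ (u₀, -v)).2 ^ 3)))).trans hg
  set L := fderiv ℝ φ (u₀, 0) (0, 1) with hL
  have hd : HasDerivAt (fun v : ℝ => φ (u₀, v)) L 0 := by
    have e1 : HasDerivAt (fun v : ℝ => ((u₀, v) : ℝ × ℝ)) ((0, 1) : ℝ × ℝ) 0 :=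
      (hasDerivAt_const 0 u₀).prodMk (hasDerivAt_id 0)
    exact HasFDerivAt.comp_hasDerivAt (0 : ℝ) (f := fun v : ℝ => ((u₀, v) : ℝ × ℝ))
      (hφ.contDiffAt.differentiableAt (by simp)).hasFDerivAt e1
  have hdn : HasDerivAt (fun v : ℝ => φ (u₀, -v)) (-L) 0 := by
    have := HasDerivAt.scomp (0 : ℝ) (h := fun v : ℝ => -v) (h' := -1)
      (g₁ := fun v : ℝ => φ (u₀, v)) (g₁' := L) (by simpa using hd) (hasDerivAt_neg 0)
    simpa [Function.comp_def] using this
  have hd1 : HasDerivAt (fun v : ℝ => (φ (u₀, v)).1) L.1 0 := by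
    simpa using hd.hasFDerivAt.fst.hasDerivAt
  have hd2 : HasDerivAt (fun v : ℝ => (φ (u₀, v)).2) L.2 0 := by
    simpa using hd.hasFDerivAt.snd.hasDerivAt
  have hdn1 : HasDerivAt (fun v : ℝ => (φ (u₀, -v)).1) (-L.1) 0 := by
    simpa using hdn.hasFDerivAt.fst.hasDerivAt
  have hdn2 : HasDerivAt (fun v : ℝ => (φ (u₀, -v)).2) (-L.2) 0 := by
    simpa using hdn.hasFDerivAt.snd.hasDerivAt
  -- the quotient of an `O(v⁵)` by `v ^ k`, `k ≤ 3`, tends to zero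
  have hquot : ∀ k ≤ 3, ∀ w : ℝ → ℝ, w =O[𝓝 0] (fun v : ℝ => v ^ 5) →
      Tendsto (fun v => w v / v ^ k) (𝓝[≠] 0) (𝓝 0) := by
    intro k hk w hw
    have h5 : (fun v : ℝ => v ^ 5) =o[𝓝 0] fun v : ℝ => v ^ k := isLittleO_pow_pow (by omega)
    exact ((hw.trans_isLittleO h5).mono nhdsWithin_le_nhds).tendsto_div_nhds_zero
  have hφz : φ (u₀, 0) = 0 := hφ0
  have hα : L.1 = 0 := by
    have e1 := (hasDerivAt_iff_tendsto_slope_zero.1 (hd1.sub hdn1))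
    have e2 := hquot 1 (by norm_num) _ hg1
    have := tendsto_nhds_unique e1 (e2.congr fun v => by simp [div_eq_inv_mul])
    linarith
  have hβ : L.2 = 0 := by
    have e1 := (hasDerivAt_iff_tendsto_slope_zero.1 hd2).pow 3
    have e1' := (hasDerivAt_iff_tendsto_slope_zero.1 hdn2).pow 3
    have e2 := hquot 3 le_rfl _ hg3
    have := tendsto_nhds_unique (e1.sub e1') (e2.congr fun v => by
      simp [hφz, div_eq_inv_mul, mul_pow, mul_sub])
    have h3 : L.2 ^ 3 = 0 := by linarith
    exact pow_eq_zero_iff (by norm_num) |>.1 h3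
  have h01 : ((0, 1) : ℝ × ℝ) = 0 :=
    hφ.fderiv_injective (by rw [map_zero]; exact Prod.ext hα hβ)
  simp at h01

/-- The differential is injective exactly off the axis `v = 0`. -/
theorem foldedMap_not_injective_fderiv_iff {p : ℝ × ℝ}
    (hf : DifferentiableAt ℝ (foldedMap a b c0 c1 c2 c3) p) (ha : DifferentiableAt ℝ a p.1)
    (h2 : ContinuousAt c2 (p.1, 0)) (h3 : ContinuousAt c3 (p.1, 0)) :
    ¬ Function.Injective (fderiv ℝ (foldedMap a b c0 c1 c2 c3) p) ↔ p.2 = 0 := by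
  obtain ⟨x, y⟩ := p
  dsimp only at ha h2 h3 ⊢
  constructor
  · contrapose!
    intro hy
    rw [injective_iff_map_eq_zero]
    rintro ⟨w1, w2⟩ hw
    have g1 := hf.hasFDerivAt.fst.unique (f := fun p : ℝ × ℝ => p.1) hasFDerivAt_fst
    have p1 : HasFDerivAt (fun y : ℝ × ℝ => y.1) (ContinuousLinearMap.fst ℝ ℝ ℝ) (x, y) :=
      hasFDerivAt_fst
    have p2 : HasFDerivAt (fun y : ℝ × ℝ => y.2) (ContinuousLinearMap.snd ℝ ℝ ℝ) (x, y) :=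
      hasFDerivAt_snd
    have g2 := hf.hasFDerivAt.snd.fst.unique (f := fun p : ℝ × ℝ => a p.1 + p.2 ^ 2)
      ((HasFDerivAt.comp (x, y) (f := fun p : ℝ × ℝ => p.1)
        ha.hasFDerivAt p1).add (p2.pow 2))
    have e1 := DFunLike.congr_fun g1 (w1, w2)
    have e2 := DFunLike.congr_fun g2 (w1, w2)
    simp only [ContinuousLinearMap.comp_apply, hw, map_zero] at e1 e2
    have hw1 : w1 = 0 := by simpa using e1.symm
    subst hw1
    have hw2 : w2 = 0 := by simpa [hy] using e2
    simp [hw2]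
  · rintro rfl hinj
    have e1 : HasDerivAt (fun v : ℝ => ((x, v) : ℝ × ℝ)) ((0, 1) : ℝ × ℝ) 0 :=
      (hasDerivAt_const 0 x).prodMk (hasDerivAt_id 0)
    have e2 := HasFDerivAt.comp_hasDerivAt (0 : ℝ) (f := fun v : ℝ => ((x, v) : ℝ × ℝ))
      hf.hasFDerivAt e1
    -- along the line `u = x` the map is a constant plus `v² * (bounded)`
    have e3 : HasDerivAt (foldedMap a b c0 c1 c2 c3 ∘ fun v : ℝ => ((x, v) : ℝ × ℝ)) 0 0 := by
      have hc2 : Tendsto (fun v : ℝ => c2 (x, v ^ 2)) (𝓝 0) (𝓝 (c2 (x, 0))) := by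
        refine h2.tendsto.comp ?_
        simpa using (Continuous.tendsto (by fun_prop : Continuous fun v : ℝ => (x, v ^ 2)) 0)
      have hc3 : Tendsto (fun v : ℝ => c3 (x, v ^ 2)) (𝓝 0) (𝓝 (c3 (x, 0))) := by
        refine h3.tendsto.comp ?_
        simpa using (Continuous.tendsto (by fun_prop : Continuous fun v : ℝ => (x, v ^ 2)) 0)
      have hv : Tendsto (fun v : ℝ => v) (𝓝 0) (𝓝 0) := tendsto_id
      have ht : Tendsto (fun v : ℝ => c0 x + v * c1 x + v ^ 2 * c2 (x, v ^ 2)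
          + v ^ 3 * c3 (x, v ^ 2)) (𝓝 0) _ :=
        ((tendsto_const_nhds.add (hv.mul tendsto_const_nhds)).add ((hv.pow 2).mul hc2)).add
          ((hv.pow 3).mul hc3)
      rw [hasDerivAt_iff_isLittleO]
      have hsq : (fun v : ℝ => v ^ 2) =o[𝓝 0] fun v : ℝ => v := by
        simpa using isLittleO_pow_pow (𝕜 := ℝ) (m := 1) (n := 2) (by norm_num)
      refine IsBigO.trans_isLittleO (g := fun v : ℝ => v ^ 2) ?_ (by simpa using hsq)
      have e : (fun v : ℝ => (foldedMap a b c0 c1 c2 c3 ∘ fun v : ℝ => ((x, v) : ℝ × ℝ)) v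
          - (foldedMap a b c0 c1 c2 c3 ∘ fun v : ℝ => ((x, v) : ℝ × ℝ)) 0 - (v - 0) • 0) =
          fun v : ℝ => ((0 : ℝ), v ^ 2, v ^ 2 * (c0 x + v * c1 x + v ^ 2 * c2 (x, v ^ 2)
          + v ^ 3 * c3 (x, v ^ 2))) := by
        funext v
        simp [foldedMap]
      rw [e]
      refine IsBigO.prod_left (isBigO_zero _ _) (IsBigO.prod_left (isBigO_refl _ _) ?_)
      simpa using (isBigO_refl (fun v : ℝ => v ^ 2) (𝓝 0)).mul (ht.isBigO_one ℝ)
    have h01 : ((0, 1) : ℝ × ℝ) = 0 := hinj (by rw [map_zero]; exact e2.unique e3)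
    simp at h01

end foldedMap

/-! ### Zeros of the coefficient `c₁` -/

/-- Implicit function theorem for `F(x,t) = t`, together with the bound of the distance of an
approximate solution from the solution by its residual. -/
theorem exists_solution_germ {F : ℝ × ℝ → ℝ} (hF : SmoothNear F 0) (hF0 : F 0 = 0)
    (hF' : fderiv ℝ F 0 (1, 0) ≠ 0) :
    ∃ u : ℝ → ℝ, SmoothNear u 0 ∧ u 0 = 0 ∧ (∀ᶠ y in 𝓝 (0 : ℝ × ℝ), F y = y.2 ↔ y.1 = u y.2) ∧
      ∀ P : ℝ → ℝ, Tendsto P (𝓝 0) (𝓝 0) →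
        (fun t => u t - P t) =O[𝓝 0] fun t => F (P t, t) - t := by
  have s2 : SmoothNear (fun y : ℝ × ℝ => y.2) 0 := contDiff_snd.smoothNear _
  have hΦ : IsLocalDiffeomorphAt 𝓘(ℝ, ℝ × ℝ) 𝓘(ℝ, ℝ × ℝ) ∞ (fun y : ℝ × ℝ => (F y, y.2)) 0 := by
    refine SmoothNear.isLocalDiffeomorphAt_of_injective (hF.prodMk s2) ?_
    have h := hF.differentiableAt.hasFDerivAt.prodMk (hasFDerivAt_snd (𝕜 := ℝ) (E := ℝ) (F := ℝ)
      (p := (0 : ℝ × ℝ)))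
    rintro ⟨w1, w2⟩ hw
    have hw' := (DFunLike.congr_fun h.fderiv (w1, w2)).symm.trans hw
    simp only [ContinuousLinearMap.prod_apply, ContinuousLinearMap.coe_snd',
      Prod.mk_eq_zero] at hw'
    obtain ⟨h1, rfl⟩ := hw'
    have hlin : ((w1, 0) : ℝ × ℝ) = w1 • ((1, 0) : ℝ × ℝ) := by simp
    rw [hlin, map_smul, smul_eq_mul] at h1
    simp [(mul_eq_zero.1 h1).resolve_right hF']
  set Φ : ℝ × ℝ → ℝ × ℝ := fun y => (F y, y.2) with hΦdef
  have hΦ0 : Φ 0 = 0 := by simp [hΦdef, hF0]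
  set g : ℝ × ℝ → ℝ × ℝ := hΦ.localInverse.toFun with hg
  have hl : ∀ᶠ y in 𝓝 (0 : ℝ × ℝ), g (Φ y) = y := hΦ.localInverse_eventuallyEq_left
  have hr : ∀ᶠ z in 𝓝 (0 : ℝ × ℝ), Φ (g z) = z := by
    have := hΦ.localInverse_eventuallyEq_right
    rwa [hΦ0] at this
  have hgs : SmoothNear g 0 := by
    have hmem := hΦ.localInverse_mem_source
    rw [hΦ0] at hmem
    filter_upwards [hΦ.localInverse_open_source.mem_nhds hmem] with z hz
    exact ((contMDiffOn_iff_contDiffOn.1 hΦ.localInverse_contMDiffOn).contDiffAt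
      (hΦ.localInverse_open_source.mem_nhds hz))
  have hg0 : g 0 = 0 := by
    have := hl.self_of_nhds
    rwa [hΦ0] at this
  have hdiag : Tendsto (fun t : ℝ => (t, t)) (𝓝 0) (𝓝 (0 : ℝ × ℝ)) :=
    Continuous.tendsto' (by fun_prop) _ _ rfl
  have hsnd : Tendsto (fun y : ℝ × ℝ => y.2) (𝓝 0) (𝓝 0) :=
    Continuous.tendsto' continuous_snd _ _ rfl
  -- over the diagonal the inverse has the form `(u t, t)`
  have hgd : ∀ᶠ t in 𝓝 (0 : ℝ), g (t, t) = ((g (t, t)).1, t) ∧ F ((g (t, t)).1, t) = t := by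
    filter_upwards [hdiag.eventually hr] with t ht
    have h1 : F (g (t, t)) = t := congrArg Prod.fst ht
    have h2 : (g (t, t)).2 = t := congrArg Prod.snd ht
    have h3 : g (t, t) = ((g (t, t)).1, t) := Prod.ext rfl h2
    exact ⟨h3, by rw [← h3]; exact h1⟩
  refine ⟨fun t => (g (t, t)).1, ?_, ?_, ?_, ?_⟩
  · have hdc : ContDiff ℝ ∞ (fun t : ℝ => (t, t)) := by fun_prop
    have h1 : SmoothNear (fun t : ℝ => g (t, t)) 0 :=
      SmoothNear.comp (f := fun t : ℝ => (t, t)) hgs (hdc.smoothNear 0)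
    exact SmoothNear.comp (g := Prod.fst) (contDiff_fst.smoothNear _) h1
  · change (g 0).1 = 0
    rw [hg0]
    rfl
  · filter_upwards [hl, hsnd.eventually hgd] with y hy hyd
    constructor
    · intro h
      have : Φ y = (y.2, y.2) := Prod.ext h rfl
      rw [this] at hy
      rw [hy]
    · intro h
      have : y = ((g (y.2, y.2)).1, y.2) := Prod.ext h rfl
      rw [this]
      exact hyd.2
  · intro P hP
    have hPt : Tendsto (fun t => (P t, t)) (𝓝 0) (𝓝 (0 : ℝ × ℝ)) := hP.prodMk_nhds tendsto_id
    have hFP : Tendsto (fun t => (F (P t, t), t)) (𝓝 0) (𝓝 (0 : ℝ × ℝ)) := by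
      have : Tendsto (fun t => F (P t, t)) (𝓝 0) (𝓝 0) := by
        have h := hF.continuousAt.tendsto.comp hPt
        rwa [hF0] at h
      exact this.prodMk_nhds tendsto_id
    have h1 : (fun t : ℝ => g (t, t) - g (F (P t, t), t)) =O[𝓝 0]
        fun t => ((t, t) : ℝ × ℝ) - (F (P t, t), t) :=
      (hgs.contDiffAt.hasStrictFDerivAt (by simp)).isBigO_sub.comp_tendsto
        (hdiag.prodMk_nhds hFP)
    have h2 : (fun t : ℝ => ((t, t) : ℝ × ℝ) - (F (P t, t), t)) =O[𝓝 0]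
        fun t => F (P t, t) - t := by
      refine IsBigO.of_bound 1 (Eventually.of_forall fun t => ?_)
      simp [Prod.norm_def, abs_sub_comm]
    have h3 : (fun t => (g (t, t)).1 - P t) =O[𝓝 0]
        fun t : ℝ => g (t, t) - g (F (P t, t), t) := by
      refine IsBigO.of_bound 1 ?_
      filter_upwards [hPt.eventually hl] with t ht
      have ht' : g (F (P t, t), t) = (P t, t) := ht
      rw [ht', one_mul]
      exact norm_fst_le (g (t, t) - (P t, t))
    exact (h3.trans h1).trans h2

/-- The right-hand side of `c₁(x,s) = s + x s d₁(s) + x² d₂(s) + x³ d₃(s) + x⁴ d₄(x,s)`. -/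
def coeffExpansion (d1 d2 d3 : ℝ → ℝ) (d4 : ℝ × ℝ → ℝ) (x : ℝ × ℝ) : ℝ :=
  x.2 + x.1 * x.2 * d1 x.2 + x.1 ^ 2 * d2 x.2 + x.1 ^ 3 * d3 x.2 + x.1 ^ 4 * d4 x

section coeffExpansion

variable {d1 d2 d3 : ℝ → ℝ} {d4 : ℝ × ℝ → ℝ}

/-- The cubic `a t + b t² + c t³` solves `c₁(x, -t²) = 0` up to `O(t⁵)` as soon as its coefficients
cancel the terms of order two, three and four. -/
theorem coeffExpansion_cubic_isBigO
    (hd1 : SmoothNear d1 0) (hd2 : SmoothNear d2 0) (hd3 : SmoothNear d3 0)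
    (hd4 : SmoothNear d4 0) {a b c : ℝ} (h1 : a ^ 2 * d2 0 - 1 = 0)
    (h2 : -a * d1 0 + 2 * a * b * d2 0 + a ^ 3 * d3 0 = 0)
    (h3 : -b * d1 0 + (b ^ 2 + 2 * a * c) * d2 0 - a ^ 2 * deriv d2 0 + 3 * a ^ 2 * b * d3 0
      + a ^ 4 * d4 (0, 0) = 0) :
    (fun t : ℝ => coeffExpansion d1 d2 d3 d4 (a * t + b * t ^ 2 + c * t ^ 3, -t ^ 2))
      =O[𝓝 0] fun t => t ^ 5 := by
  set P : ℝ → ℝ := fun t => a * t + b * t ^ 2 + c * t ^ 3 with hP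
  have hs : Tendsto (fun t : ℝ => -t ^ 2) (𝓝 0) (𝓝 0) :=
    Continuous.tendsto' (by fun_prop) _ _ (by simp)
  have hP0 : Tendsto P (𝓝 0) (𝓝 0) := Continuous.tendsto' (by fun_prop) _ _ (by simp [hP])
  have hPO : P =O[𝓝 0] fun t => t := by
    have e : P = fun t => t * (a + b * t + c * t ^ 2) := by
      funext t
      simp only [hP]
      ring
    have hc : Tendsto (fun t : ℝ => a + b * t + c * t ^ 2) (𝓝 0) (𝓝 (a + b * 0 + c * 0 ^ 2)) :=
      Continuous.tendsto (by fun_prop) 0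
    rw [e]
    simpa using (isBigO_refl (fun t : ℝ => t) (𝓝 0)).mul (hc.isBigO_one ℝ)
  have ht2 : (fun t : ℝ => t ^ 2) =O[𝓝 0] fun t => t ^ 2 := isBigO_refl _ _
  have first_order : ∀ d : ℝ → ℝ, SmoothNear d 0 →
      (fun t : ℝ => d (-t ^ 2) - d 0) =O[𝓝 0] fun t => t ^ 2 := by
    intro d hd
    have := (hd.differentiableAt.isBigO_sub).comp_tendsto hs
    refine this.trans ?_
    simpa [Function.comp_def] using ht2
  have r1 := first_order d1 hd1
  have r3 := first_order d3 hd3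
  have r2 : (fun t : ℝ => d2 (-t ^ 2) - d2 0 + t ^ 2 * deriv d2 0) =O[𝓝 0] fun t => t ^ 4 := by
    have hT := hd2.sub_linear_isBigO
    have := hT.comp_tendsto hs
    refine (this.congr (fun t => ?_) (fun t => ?_))
    · simp only [Function.comp_apply]
      ring
    · simp only [Function.comp_apply]
      ring
  have r4 : (fun t : ℝ => d4 (P t, -t ^ 2) - d4 (0, 0)) =O[𝓝 0] fun t => t := by
    have hy : Tendsto (fun t => (P t, -t ^ 2)) (𝓝 0) (𝓝 (0 : ℝ × ℝ)) := hP0.prodMk_nhds hs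
    have := (hd4.differentiableAt.isBigO_sub).comp_tendsto hy
    refine this.trans ?_
    have h2 : (fun t : ℝ => -t ^ 2) =O[𝓝 0] fun t => t := by
      simpa using (isLittleO_pow_pow (𝕜 := ℝ) (m := 1) (n := 2) (by norm_num)).isBigO
    simpa [Function.comp_def] using hPO.prod_left h2
  -- the polynomial part, divided by `t⁵`
  set Q : ℝ → ℝ := fun t => -c * d1 0 + d2 0 * (2 * b * c + c ^ 2 * t)
    - deriv d2 0 * (2 * a * b + t * (b ^ 2 + 2 * a * c) + t ^ 2 * (2 * b * c + c ^ 2 * t))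
    + d3 0 * (3 * a ^ 2 * c + 3 * a * (b + c * t) ^ 2 + t * (b + c * t) ^ 3)
    + d4 (0, 0) * ((b + c * t) * ((a + b * t + c * t ^ 2) ^ 3 + (a + b * t + c * t ^ 2) ^ 2 * a
      + (a + b * t + c * t ^ 2) * a ^ 2 + a ^ 3)) with hQ
  have hQO : (fun t => t ^ 5 * Q t) =O[𝓝 0] fun t => t ^ 5 := by
    have hc : Tendsto Q (𝓝 0) (𝓝 (Q 0)) := Continuous.tendsto (by fun_prop) 0
    simpa using (isBigO_refl (fun t : ℝ => t ^ 5) (𝓝 0)).mul (hc.isBigO_one ℝ)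
  have t1 : (fun t => P t * t ^ 2 * (d1 (-t ^ 2) - d1 0)) =O[𝓝 0] fun t => t ^ 5 :=
    ((hPO.mul ht2).mul r1).congr_right fun t => by ring
  have t2 : (fun t => P t ^ 2 * (d2 (-t ^ 2) - d2 0 + t ^ 2 * deriv d2 0)) =O[𝓝 0]
      fun t => t ^ 5 := by
    have h6 : (fun t : ℝ => t ^ 2 * t ^ 4) =O[𝓝 0] fun t => t ^ 5 := by
      have := (isLittleO_pow_pow (𝕜 := ℝ) (m := 5) (n := 6) (by norm_num)).isBigO
      exact this.congr_left fun t => by ring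
    exact ((hPO.pow 2).mul r2).trans h6
  have t3 : (fun t => P t ^ 3 * (d3 (-t ^ 2) - d3 0)) =O[𝓝 0] fun t => t ^ 5 :=
    ((hPO.pow 3).mul r3).congr_right fun t => by ring
  have t4 : (fun t => P t ^ 4 * (d4 (P t, -t ^ 2) - d4 (0, 0))) =O[𝓝 0] fun t => t ^ 5 :=
    ((hPO.pow 4).mul r4).congr_right fun t => by ring
  refine ((((hQO.sub t1).add t2).add t3).add t4).congr_left fun t => ?_
  simp only [coeffExpansion, hQ, hP]
  linear_combination (-t ^ 2) * h1 - t ^ 3 * h2 - t ^ 4 * h3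

/-- Near the origin `c₁(x,-t²) = E (F² - t²)` with a unit `E` and a function `F`, even in `t`, for
which `F(x,t) = A x + …`. Here `E = 1 + x d₁` and `F(x,t) = A x T(x,-t²)` with
`T² = (d₂ + x d₃ + x² d₄) / (A² E)`; keeping the sign of `A` in `F` makes the solution of `F = t` start
with `t / A`. -/
theorem coeffExpansion_factorization
    (hd1 : SmoothNear d1 0) (hd2 : SmoothNear d2 0) (hd3 : SmoothNear d3 0)
    (hd4 : SmoothNear d4 0) {A : ℝ} (hA : A ≠ 0) (hA2 : d2 0 = A ^ 2) :
    ∃ E T : ℝ × ℝ → ℝ, SmoothNear E 0 ∧ SmoothNear T 0 ∧ E 0 = 1 ∧ T 0 = 1 ∧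
      ∀ᶠ x in 𝓝 (0 : ℝ × ℝ),
        coeffExpansion d1 d2 d3 d4 x = E x * ((A * x.1 * T x) ^ 2 + x.2) := by
  have s1 : SmoothNear (fun y : ℝ × ℝ => y.1) 0 := contDiff_fst.smoothNear _
  have s2 : SmoothNear (fun y : ℝ × ℝ => y.2) 0 := contDiff_snd.smoothNear _
  have one : SmoothNear (fun _ : ℝ × ℝ => (1 : ℝ)) 0 := contDiff_const.smoothNear _
  have pull : ∀ d : ℝ → ℝ, SmoothNear d 0 → SmoothNear (fun y : ℝ × ℝ => d y.2) 0 :=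
    fun d hd => SmoothNear.comp (f := fun y : ℝ × ℝ => y.2) hd s2
  have hE : SmoothNear (fun y : ℝ × ℝ => 1 + y.1 * d1 y.2) 0 := one.add (s1.mul (pull d1 hd1))
  have hD : SmoothNear (fun y : ℝ × ℝ => d2 y.2 + y.1 * d3 y.2 + y.1 * y.1 * d4 y) 0 :=
    ((pull d2 hd2).add (s1.mul (pull d3 hd3))).add ((s1.mul s1).mul hd4)
  have hAE : SmoothNear (fun y : ℝ × ℝ => A ^ 2 * (1 + y.1 * d1 y.2)) 0 :=
    SmoothNear.mul (contDiff_const.smoothNear _) hE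
  have hR := hD.mul (hAE.inv (by simpa using hA))
  have hR0 : (d2 (0 : ℝ × ℝ).2 + (0 : ℝ × ℝ).1 * d3 (0 : ℝ × ℝ).2
      + (0 : ℝ × ℝ).1 * (0 : ℝ × ℝ).1 * d4 0)
      * (A ^ 2 * (1 + (0 : ℝ × ℝ).1 * d1 (0 : ℝ × ℝ).2))⁻¹ = 1 := by
    simp [hA2, hA]
  refine ⟨_, _, hE, hR.sqrt (by rw [hR0]; exact one_ne_zero), by simp, by simp [hA2, hA], ?_⟩
  have hE1 := hE.continuousAt.eventually_ne (y := 0) (by simp)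
  have hRpos := hR.continuousAt.tendsto.eventually_const_lt (lt_of_lt_of_eq one_pos hR0.symm)
  filter_upwards [hE1, hRpos] with x hx1 hx2
  rw [mul_pow, Real.sq_sqrt hx2.le, coeffExpansion]
  field_simp
  ring

/-- The zeros of `c₁(·,-t²)` are `u(t)` and `u(-t)`, where `u` solves `F(u(t),t) = t` in the
factorization `c₁(x,-t²) = E (F² - t²)`; since `F` is even in `t`, the solution of `F = -t` is
`u(-t)`. For `t ≠ 0` they are distinct and simple. -/
theorem exists_coeffExpansion_root_germ
    (hd1 : SmoothNear d1 0) (hd2 : SmoothNear d2 0) (hd3 : SmoothNear d3 0)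
    (hd4 : SmoothNear d4 0) {A : ℝ} (hA : A ≠ 0) (hA2 : d2 0 = A ^ 2) :
    ∃ u : ℝ → ℝ, SmoothNear u 0 ∧ u 0 = 0 ∧
      (fun t : ℝ => u t -
        (1 / A * t
          + 1 / (2 * A ^ 4) * (d1 0 * A ^ 2 - d3 0) * t ^ 2
          + 1 / (8 * A ^ 7) *
              ((d1 0 ^ 2 + 4 * deriv d2 0) * A ^ 4
                - 2 * (3 * d1 0 * d3 0 + 2 * d4 (0, 0)) * A ^ 2
                + 5 * d3 0 ^ 2) * t ^ 3)) =O[𝓝 0] (fun t : ℝ => t ^ 4) ∧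
      (∀ᶠ y in 𝓝 (0 : ℝ × ℝ), coeffExpansion d1 d2 d3 d4 (y.1, -y.2 ^ 2) = 0 ↔
        y.1 = u y.2 ∨ y.1 = u (-y.2)) ∧
      (∀ᶠ t in 𝓝 (0 : ℝ), t ≠ 0 → u t ≠ 0 ∧ u t ≠ u (-t)) ∧
      (∀ᶠ y in 𝓝 (0 : ℝ × ℝ), y.2 ≠ 0 → coeffExpansion d1 d2 d3 d4 (y.1, -y.2 ^ 2) = 0 →
        deriv (fun x => coeffExpansion d1 d2 d3 d4 (x, -y.2 ^ 2)) y.1 ≠ 0) ∧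
      ∀ᶠ y in 𝓝 (0 : ℝ × ℝ), 0 < y.2 → coeffExpansion d1 d2 d3 d4 y ≠ 0 := by
  obtain ⟨E, T, hE, hT, hE0, hT0, hfac⟩ := coeffExpansion_factorization hd1 hd2 hd3 hd4 hA hA2
  have hin : ContDiff ℝ ∞ (fun y : ℝ × ℝ => (y.1, -y.2 ^ 2)) := by fun_prop
  have hin0 : (fun y : ℝ × ℝ => (y.1, -y.2 ^ 2)) 0 = 0 := by simp
  have htin : Tendsto (fun y : ℝ × ℝ => (y.1, -y.2 ^ 2)) (𝓝 0) (𝓝 0) :=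
    hin.continuous.tendsto' _ _ hin0
  have hT' : SmoothNear (fun y : ℝ × ℝ => T (y.1, -y.2 ^ 2)) 0 :=
    SmoothNear.comp (f := fun y : ℝ × ℝ => (y.1, -y.2 ^ 2))
      (by simpa [Prod.mk_zero_zero] using hT) (hin.smoothNear 0)
  have hE' : SmoothNear (fun y : ℝ × ℝ => E (y.1, -y.2 ^ 2)) 0 :=
    SmoothNear.comp (f := fun y : ℝ × ℝ => (y.1, -y.2 ^ 2))
      (by simpa [Prod.mk_zero_zero] using hE) (hin.smoothNear 0)
  set F : ℝ × ℝ → ℝ := fun y => A * y.1 * T (y.1, -y.2 ^ 2) with hFdef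
  have hAx : ContDiff ℝ ∞ (fun y : ℝ × ℝ => A * y.1) := by fun_prop
  have hF : SmoothNear F 0 := (hAx.smoothNear 0).mul hT'
  have hF0 : F 0 = 0 := by simp [hFdef]
  have heven : ∀ x t, F (x, -t) = F (x, t) := by simp [hFdef]
  have hline : ∀ y : ℝ × ℝ, HasDerivAt (fun x : ℝ => ((x, y.2) : ℝ × ℝ)) ((1, 0) : ℝ × ℝ) y.1 :=
    fun y => (hasDerivAt_id y.1).prodMk (hasDerivAt_const y.1 y.2)
  have hFline : ∀ y, DifferentiableAt ℝ F y →
      HasDerivAt (fun x => F (x, y.2)) (fderiv ℝ F y (1, 0)) y.1 := fun y hy =>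
    HasFDerivAt.comp_hasDerivAt y.1 (f := fun x : ℝ => ((x, y.2) : ℝ × ℝ)) hy.hasFDerivAt (hline y)
  have hF'0 : fderiv ℝ F 0 (1, 0) = A := by
    have h1 := (hAx.smoothNear 0).differentiableAt.hasFDerivAt.mul hT'.differentiableAt.hasFDerivAt
    have h2 : HasFDerivAt (fun y : ℝ × ℝ => A * y.1) (A • ContinuousLinearMap.fst ℝ ℝ ℝ) 0 :=
      hasFDerivAt_fst.const_mul A
    have h3 := DFunLike.congr_fun h1.fderiv (1, 0)
    rw [h2.fderiv] at h3
    refine h3.trans ?_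
    have : T (0, 0) = 1 := hT0
    simp [this]
  have hfacF : ∀ᶠ y in 𝓝 (0 : ℝ × ℝ), coeffExpansion d1 d2 d3 d4 (y.1, -y.2 ^ 2) =
      E (y.1, -y.2 ^ 2) * (F y ^ 2 - y.2 ^ 2) := by
    filter_upwards [htin.eventually hfac] with y hy
    rw [hy]
    simp only [hFdef]
    ring
  have hEne : ∀ᶠ y in 𝓝 (0 : ℝ × ℝ), E (y.1, -y.2 ^ 2) ≠ 0 :=
    hE'.continuousAt.eventually_ne (by
      have : E (0, 0) = 1 := hE0
      simp [this])
  obtain ⟨u, hu, hu0, hiff, hdist⟩ := exists_solution_germ hF hF0 (by rw [hF'0]; exact hA)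
  have hneg : Tendsto (fun y : ℝ × ℝ => (y.1, -y.2)) (𝓝 0) (𝓝 0) :=
    Continuous.tendsto' (by fun_prop) _ _ (by simp)
  have hut : Tendsto u (𝓝 0) (𝓝 0) := by simpa [hu0] using hu.continuousAt.tendsto
  refine ⟨u, hu, hu0, ?_, ?_, ?_, ?_, ?_⟩
  · set a := 1 / A with ha
    set b := 1 / (2 * A ^ 4) * (d1 0 * A ^ 2 - d3 0) with hb
    set c := 1 / (8 * A ^ 7) * ((d1 0 ^ 2 + 4 * deriv d2 0) * A ^ 4
      - 2 * (3 * d1 0 * d3 0 + 2 * d4 (0, 0)) * A ^ 2 + 5 * d3 0 ^ 2) with hc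
    have hO5 := coeffExpansion_cubic_isBigO hd1 hd2 hd3 hd4 (a := a) (b := b) (c := c)
      (by rw [hA2, ha]; field_simp; ring)
      (by rw [hA2, hb, ha]; field_simp; ring)
      (by rw [hA2, hc, hb, ha]; field_simp; ring)
    set P : ℝ → ℝ := fun t => a * t + b * t ^ 2 + c * t ^ 3 with hP
    have hP0 : Tendsto P (𝓝 0) (𝓝 0) := Continuous.tendsto' (by fun_prop) _ _ (by simp [hP])
    have hPt : Tendsto (fun t => (P t, t)) (𝓝 0) (𝓝 (0 : ℝ × ℝ)) := hP0.prodMk_nhds tendsto_id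
    refine (hdist P hP0).trans ?_
    -- `c₁(P(t),-t²) = t (F(P(t),t) - t) M(t)` with `M(t) → 2`
    set M : ℝ → ℝ := fun t => E (P t, -t ^ 2) *
      (A * (a + b * t + c * t ^ 2) * T (P t, -t ^ 2) + 1) with hM
    have hM2 : Tendsto M (𝓝 0) (𝓝 2) := by
      have e1 := hE'.continuousAt.tendsto.comp hPt
      have e2 := hT'.continuousAt.tendsto.comp hPt
      have e3 : Tendsto (fun t : ℝ => A * (a + b * t + c * t ^ 2)) (𝓝 0) (𝓝 1) :=
        Continuous.tendsto' (by fun_prop) _ _ (by simp [ha, hA])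
      have e4 := e1.mul ((e3.mul e2).add_const 1)
      have hE00 : E (0, 0) = 1 := hE0
      have hT00 : T (0, 0) = 1 := hT0
      have e5 : E ((0 : ℝ × ℝ).1, -(0 : ℝ × ℝ).2 ^ 2) *
          (1 * T ((0 : ℝ × ℝ).1, -(0 : ℝ × ℝ).2 ^ 2) + 1) = 2 := by
        simp [hE00, hT00]
        norm_num
      rw [e5] at e4
      exact e4
    obtain ⟨C, hC⟩ := hO5.bound
    refine IsBigO.of_bound C ?_
    filter_upwards [hC, hPt.eventually hfacF, hM2.eventually_const_lt one_lt_two] with t h1 h2 h3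
    have e : coeffExpansion d1 d2 d3 d4 (P t, -t ^ 2) = t * (F (P t, t) - t) * M t := by
      rw [h2]
      simp only [hFdef, hM, hP]
      ring
    rcases eq_or_ne t 0 with rfl | ht
    · simp [hP, hFdef]
    · change ‖coeffExpansion d1 d2 d3 d4 (P t, -t ^ 2)‖ ≤ _ at h1
      rw [e, norm_mul (t * _) (M t), norm_mul t, pow_succ' t 4, norm_mul t] at h1
      have ht' : 0 < ‖t‖ := norm_pos_iff.2 ht
      have hM1 : 1 ≤ ‖M t‖ := h3.le.trans (le_abs_self _)
      have h4 : ‖t‖ * ‖F (P t, t) - t‖ ≤ ‖t‖ * (C * ‖t ^ 4‖) :=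
        calc ‖t‖ * ‖F (P t, t) - t‖ ≤ ‖t‖ * ‖F (P t, t) - t‖ * ‖M t‖ :=
              le_mul_of_one_le_right (by positivity) hM1
          _ ≤ C * (‖t‖ * ‖t ^ 4‖) := h1
          _ = ‖t‖ * (C * ‖t ^ 4‖) := by ring
      exact le_of_mul_le_mul_left h4 ht'
  · filter_upwards [hiff, hneg.eventually hiff, hfacF, hEne] with y h1 h2 h3 h4
    rw [heven] at h2
    rw [h3, ← h1, ← h2, mul_eq_zero, or_iff_right h4, sub_eq_zero, sq_eq_sq_iff_eq_or_eq_neg]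
  · have hz : Tendsto (fun t : ℝ => ((0, t) : ℝ × ℝ)) (𝓝 0) (𝓝 0) :=
      Continuous.tendsto' (by fun_prop) _ _ rfl
    have hu1 : Tendsto (fun t : ℝ => (u t, t)) (𝓝 0) (𝓝 (0 : ℝ × ℝ)) := hut.prodMk_nhds tendsto_id
    filter_upwards [hz.eventually hiff, hu1.eventually hiff, (hneg.comp hu1).eventually hiff]
      with t h1 h2 h3 ht
    constructor
    · intro h0
      have := h1.2 h0.symm
      simp only [hFdef, mul_zero, zero_mul] at this
      exact ht this.symm
    · intro h0
      have e1 : F (u t, t) = t := h2.2 rfl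
      have e2 : F (u t, -t) = -t := h3.2 h0
      rw [heven, e1] at e2
      exact ht (by linarith)
  · have hF'c : ∀ᶠ y in 𝓝 (0 : ℝ × ℝ), fderiv ℝ F y (1, 0) ≠ 0 := by
      have hc : ContinuousAt (fun y => fderiv ℝ F y (1, 0)) 0 :=
        (hF.contDiffAt.continuousAt_fderiv (by simp)).clm_apply continuousAt_const
      exact hc.eventually_ne (by rw [hF'0]; exact hA)
    filter_upwards [hfacF.eventually_nhds, hEne, hF, hE', hF'c] with y h1 h2 h3 h4 h5 hy hz
    have hdF := hFline y (h3.differentiableAt (by simp))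
    have hdE := HasFDerivAt.comp_hasDerivAt y.1 (f := fun x : ℝ => ((x, y.2) : ℝ × ℝ))
      (h4.differentiableAt (by simp)).hasFDerivAt (hline y)
    have hd := hdE.mul ((hdF.pow 2).sub_const (y.2 ^ 2))
    have hyc : Tendsto (fun x : ℝ => ((x, y.2) : ℝ × ℝ)) (𝓝 y.1) (𝓝 y) :=
      Continuous.tendsto' (by fun_prop) _ _ rfl
    have hsq : F y ^ 2 - y.2 ^ 2 = 0 := by
      have := h1.self_of_nhds
      rw [hz] at this
      exact (mul_eq_zero.1 this.symm).resolve_left h2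
    rw [(hd.congr_of_eventuallyEq (hyc.eventually h1)).deriv]
    have hFne : F y ≠ 0 := by
      intro h0
      rw [h0] at hsq
      exact hy (by simpa using hsq)
    simp [hsq, h2, hFne, h5]
  · filter_upwards [hfac, hE.continuousAt.tendsto.eventually_const_lt
      (lt_of_lt_of_eq one_pos hE0.symm)]
      with y h1 h2 hy
    rw [h1]
    positivity

end coeffExpansion

/-! ### The normal form -/

theorem SmoothNear.eventually_slice {f : ℝ × ℝ → ℝ} (hf : SmoothNear f 0) :
    ∀ᶠ x in 𝓝 (0 : ℝ × ℝ), SmoothNear (fun u => f (u, x.2)) x.1 := by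
  filter_upwards [hf.eventually] with x hx
  have hin : ContDiff ℝ ∞ (fun u : ℝ => (u, x.2)) := by fun_prop
  exact SmoothNear.comp (f := fun u : ℝ => (u, x.2)) hx (hin.smoothNear _)

theorem SmoothNear.eventually_slice_axis {f : ℝ × ℝ × ℝ → ℝ} (hf : SmoothNear f 0) :
    ∀ᶠ x in 𝓝 (0 : ℝ × ℝ), SmoothNear (fun y : ℝ × ℝ => f (y.1, y.2, x.2)) (x.1, 0) := by
  have ht : Tendsto (fun x : ℝ × ℝ => (x.1, (0 : ℝ), x.2)) (𝓝 0) (𝓝 0) :=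
    Continuous.tendsto' (by fun_prop) _ _ rfl
  filter_upwards [ht.eventually hf.eventually] with x hx
  have hin : ContDiff ℝ ∞ (fun y : ℝ × ℝ => (y.1, y.2, x.2)) := by fun_prop
  exact SmoothNear.comp (f := fun y : ℝ × ℝ => (y.1, y.2, x.2)) hx (hin.smoothNear _)

namespace DeformationNormalForm

variable (N : DeformationNormalForm)

theorem map_eq_foldedMap (s : ℝ) : N.map s =
    foldedMap (fun u => u ^ 2 * N.f21 u + u * s * N.f24 (u, s))
      (fun u => u ^ 2 * N.f31 u + u * s * N.f34 (u, s)) (fun u => N.c0 (u, s))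
      (fun u => N.c1 (u, s)) (fun y => N.c2 (y.1, y.2, s)) (fun y => N.c3 (y.1, y.2, s)) := by
  funext p
  simp only [map, foldedMap, f32, Prod.mk.injEq, true_and]
  constructor <;> ring

theorem eventually_smoothNear_base {f : ℝ → ℝ} {g : ℝ × ℝ → ℝ} (hf : SmoothNear f 0)
    (hg : SmoothNear g 0) :
    ∀ᶠ x in 𝓝 (0 : ℝ × ℝ), SmoothNear (fun u => u ^ 2 * f u + u * x.2 * g (u, x.2)) x.1 := by
  have ht : Tendsto (fun x : ℝ × ℝ => x.1) (𝓝 0) (𝓝 0) := Continuous.tendsto' continuous_fst _ _ rfl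
  filter_upwards [ht.eventually hf.eventually, hg.eventually_slice] with x h1 h2
  have e1 : ContDiff ℝ ∞ (fun u : ℝ => u ^ 2) := by fun_prop
  have e2 : ContDiff ℝ ∞ (fun u : ℝ => u * x.2) := by fun_prop
  exact ((e1.smoothNear _).mul h1).add ((e2.smoothNear _).mul h2)

theorem smoothNear_map : SmoothNear (fun y : (ℝ × ℝ) × ℝ => N.map y.2 y.1) 0 := by
  have su : ContDiff ℝ ∞ (fun y : (ℝ × ℝ) × ℝ => y.1.1) := by fun_prop
  have hus : SmoothNear (fun y : (ℝ × ℝ) × ℝ => (y.1.1, y.2)) 0 :=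
    ContDiff.smoothNear (by fun_prop) 0
  have huvs : SmoothNear (fun y : (ℝ × ℝ) × ℝ => (y.1.1, y.1.2 ^ 2, y.2)) 0 :=
    ContDiff.smoothNear (by fun_prop) 0
  have pull1 : ∀ f : ℝ → ℝ, SmoothNear f 0 → SmoothNear (fun y : (ℝ × ℝ) × ℝ => f y.1.1) 0 :=
    fun f hf => SmoothNear.comp (f := fun y : (ℝ × ℝ) × ℝ => y.1.1) hf (su.smoothNear 0)
  have pull2 : ∀ f : ℝ × ℝ → ℝ, SmoothNear f 0 →
      SmoothNear (fun y : (ℝ × ℝ) × ℝ => f (y.1.1, y.2)) 0 :=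
    fun f hf => SmoothNear.comp (f := fun y : (ℝ × ℝ) × ℝ => (y.1.1, y.2)) hf hus
  have pull3 : ∀ f : ℝ × ℝ × ℝ → ℝ, SmoothNear f 0 →
      SmoothNear (fun y : (ℝ × ℝ) × ℝ => f (y.1.1, y.1.2 ^ 2, y.2)) 0 :=
    fun f hf => SmoothNear.comp (f := fun y : (ℝ × ℝ) × ℝ => (y.1.1, y.1.2 ^ 2, y.2))
      (by simpa [Prod.mk_zero_zero] using hf) huvs
  filter_upwards [pull1 _ N.smooth_f21, pull1 _ N.smooth_f31, pull2 _ N.smooth_f24,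
    pull2 _ N.smooth_f34, pull2 _ N.smooth_c0, pull2 _ N.smooth_c1, pull3 _ N.smooth_c2,
    pull3 _ N.smooth_c3] with y h1 h2 h3 h4 h5 h6 h7 h8
  unfold map f32
  fun_prop

theorem eventually_mem_nonEdgeSingularSet_iff :
    ∀ᶠ y in 𝓝 (0 : (ℝ × ℝ) × ℝ),
      y.1 ∈ nonEdgeSingularSet (N.map y.2) ↔ y.1.2 = 0 ∧ N.c1 (y.1.1, y.2) = 0 := by
  have ht : Tendsto (fun y : (ℝ × ℝ) × ℝ => (y.1.1, y.2)) (𝓝 0) (𝓝 0) :=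
    Continuous.tendsto' (by fun_prop) _ _ rfl
  filter_upwards [N.smoothNear_map,
    ht.eventually (eventually_smoothNear_base N.smooth_f21 N.smooth_f24),
    ht.eventually (eventually_smoothNear_base N.smooth_f31 N.smooth_f34),
    ht.eventually N.smooth_c0.eventually_slice, ht.eventually N.smooth_c1.eventually_slice,
    ht.eventually N.smooth_c2.eventually_slice_axis,
    ht.eventually N.smooth_c3.eventually_slice_axis] with y h ha hb h0 h1 h2 h3
  obtain ⟨⟨u, v⟩, s⟩ := y
  have hd : DifferentiableAt ℝ (N.map s) (u, v) := by
    have hin : DifferentiableAt ℝ (fun p : ℝ × ℝ => (p, s)) (u, v) := by fun_prop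
    exact DifferentiableAt.comp (u, v) (f := fun p : ℝ × ℝ => (p, s))
      (h.differentiableAt (by simp)) hin
  rw [nonEdgeSingularSet, Set.mem_ofPred_eq]
  rw [map_eq_foldedMap] at hd ⊢
  rw [foldedMap_not_injective_fderiv_iff hd ha.differentiableAt h2.continuousAt h3.continuousAt]
  refine and_congr_right fun hv => ?_
  obtain rfl : v = 0 := hv
  constructor
  · intro hne
    by_contra hc
    exact hne (foldedMap_isCuspidalEdge ha hb h0 h1 h2 h3 hc)
  · exact fun hc => foldedMap_not_isCuspidalEdge h2 h3 hc

theorem eventually_isCuspidalCrossCap :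
    ∀ᶠ x in 𝓝 (0 : ℝ × ℝ), N.c1 x = 0 → deriv (fun u => N.c1 (u, x.2)) x.1 ≠ 0 →
      IsCuspidalCrossCap (N.map x.2) (x.1, 0) := by
  filter_upwards [eventually_smoothNear_base N.smooth_f21 N.smooth_f24,
    eventually_smoothNear_base N.smooth_f31 N.smooth_f34,
    N.smooth_c0.eventually_slice, N.smooth_c1.eventually_slice,
    N.smooth_c2.eventually_slice_axis, N.smooth_c3.eventually_slice_axis]
    with x ha hb h0 h1 h2 h3 hz hd
  rw [map_eq_foldedMap]
  exact foldedMap_isCuspidalCrossCap ha hb h0 h1 h2 h3 hz hd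

end DeformationNormalForm

theorem mainTheorem3 (N : DeformationNormalForm)
    (hS1 : IsCuspidalS 1 1 (N.map 0) 0 ∨ IsCuspidalS 1 (-1) (N.map 0) 0)
    (d1 d2 d3 : ℝ → ℝ) (d4 : ℝ × ℝ → ℝ)
    (hd1 : SmoothNear d1 0) (hd2 : SmoothNear d2 0) (hd3 : SmoothNear d3 0)
    (hd4 : SmoothNear d4 0)
    (hc1 : ∀ᶠ x : ℝ × ℝ in 𝓝 0, N.c1 x =
      x.2 + x.1 * x.2 * d1 x.2 + x.1 ^ 2 * d2 x.2 + x.1 ^ 3 * d3 x.2 + x.1 ^ 4 * d4 x)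
    (d20 : ℝ) (hd20 : d2 0 = d20 ^ 2) (hpos : 0 < d2 0) :
    ∃ u : ℝ → ℝ, SmoothNear u 0 ∧ u 0 = 0 ∧
      (fun t : ℝ => u t -
        (1 / d20 * t
          + 1 / (2 * d20 ^ 4) * (d1 0 * d20 ^ 2 - d3 0) * t ^ 2
          + 1 / (8 * d20 ^ 7) *
              ((d1 0 ^ 2 + 4 * deriv d2 0) * d20 ^ 4
                - 2 * (3 * d1 0 * d3 0 + 2 * d4 (0, 0)) * d20 ^ 2
                + 5 * d3 0 ^ 2) * t ^ 3)) =O[𝓝 0] (fun t : ℝ => t ^ 4) ∧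
      ∃ U ∈ 𝓝 (0 : ℝ × ℝ), ∃ δ > 0,
        (∀ s : ℝ, 0 < s → s < δ → nonEdgeSingularSet (N.map s) ∩ U = ∅) ∧
        (∀ t : ℝ, |t| < δ →
          nonEdgeSingularSet (N.map (-t ^ 2)) ∩ U = {(u t, 0), (u (-t), 0)}) ∧
        (∀ t : ℝ, |t| < δ → t ≠ 0 →
          u t ≠ 0 ∧ u t ≠ u (-t) ∧
          IsCuspidalCrossCap (N.map (-t ^ 2)) (u t, 0) ∧
          IsCuspidalCrossCap (N.map (-t ^ 2)) (u (-t), 0)) := by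
  have hA : d20 ≠ 0 := by
    rintro rfl
    simp [hd20] at hpos
  have hc1' : ∀ᶠ x : ℝ × ℝ in 𝓝 0, N.c1 x = coeffExpansion d1 d2 d3 d4 x := hc1
  obtain ⟨u, hu, hu0, hexp, hroot, hne, hderiv, hspos⟩ :=
    exists_coeffExpansion_root_germ hd1 hd2 hd3 hd4 hA hd20
  refine ⟨u, hu, hu0, hexp, ?_⟩
  have hut : Tendsto u (𝓝 0) (𝓝 0) := by simpa [hu0] using hu.continuousAt.tendsto
  have hproj : Tendsto (fun y : (ℝ × ℝ) × ℝ => (y.1.1, y.2)) (𝓝 0) (𝓝 0) :=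
    Continuous.tendsto' (by fun_prop) _ _ rfl
  have hsq3 : Tendsto (fun y : (ℝ × ℝ) × ℝ => (y.1, -y.2 ^ 2)) (𝓝 0) (𝓝 0) :=
    Continuous.tendsto' (by fun_prop) _ _ (by simp)
  have hsq2 : Tendsto (fun y : ℝ × ℝ => (y.1, -y.2 ^ 2)) (𝓝 0) (𝓝 0) :=
    Continuous.tendsto' (by fun_prop) _ _ (by simp)
  have hcurve : Tendsto (fun t => (u t, t)) (𝓝 0) (𝓝 (0 : ℝ × ℝ)) := hut.prodMk_nhds tendsto_id
  have hpositive : ∀ᶠ y in 𝓝 (0 : (ℝ × ℝ) × ℝ), 0 < y.2 →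
      y.1 ∉ nonEdgeSingularSet (N.map y.2) := by
    filter_upwards [N.eventually_mem_nonEdgeSingularSet_iff, hproj.eventually hc1',
      hproj.eventually hspos] with y h1 h2 h3 hy hmem
    exact h3 hy (h2 ▸ (h1.1 hmem).2)
  have hnonpos : ∀ᶠ y in 𝓝 (0 : (ℝ × ℝ) × ℝ),
      y.1 ∈ nonEdgeSingularSet (N.map (-y.2 ^ 2)) ↔
        y.1.2 = 0 ∧ (y.1.1 = u y.2 ∨ y.1.1 = u (-y.2)) := by
    filter_upwards [hsq3.eventually N.eventually_mem_nonEdgeSingularSet_iff,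
      hproj.eventually (hsq2.eventually hc1'), hproj.eventually hroot] with y h1 h2 h3
    rw [h1, ← h3]
    simp only [h2]
  have hcap : ∀ᶠ t in 𝓝 (0 : ℝ), t ≠ 0 →
      u t ≠ 0 ∧ u t ≠ u (-t) ∧ IsCuspidalCrossCap (N.map (-t ^ 2)) (u t, 0) := by
    filter_upwards [hne, hcurve.eventually hroot, hcurve.eventually hderiv,
      hcurve.eventually (hsq2.eventually hc1'.eventually_nhds),
      hcurve.eventually (hsq2.eventually N.eventually_isCuspidalCrossCap)]
      with t h1 h2 h3 h4 h5 ht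
    have hzero := h2.2 (Or.inl rfl)
    refine ⟨(h1 ht).1, (h1 ht).2, h5 (h4.self_of_nhds.trans hzero) ?_⟩
    have hin : Tendsto (fun x : ℝ => (x, -t ^ 2)) (𝓝 (u t)) (𝓝 (u t, -t ^ 2)) :=
      Continuous.tendsto (by fun_prop) _
    have hloc : (fun x => N.c1 (x, -t ^ 2)) =ᶠ[𝓝 (u t)]
        fun x => coeffExpansion d1 d2 d3 d4 (x, -t ^ 2) := hin.eventually h4
    have := h3 ht hzero
    rwa [← hloc.deriv_eq] at this
  obtain ⟨r₁, hr₁, h₁⟩ := Metric.eventually_nhds_iff_ball.1 hpositive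
  obtain ⟨r₂, hr₂, h₂⟩ := Metric.eventually_nhds_iff_ball.1 hnonpos
  set r := min r₁ r₂ with hr
  have hr0 : 0 < r := lt_min hr₁ hr₂
  obtain ⟨r₃, hr₃, h₃⟩ := Metric.eventually_nhds_iff_ball.1
    (hcap.and (hut.eventually (Metric.ball_mem_nhds (0 : ℝ) hr0)))
  have hmem : ∀ p ∈ Metric.ball (0 : ℝ × ℝ) r, ∀ s : ℝ, |s| < r →
      (p, s) ∈ Metric.ball (0 : (ℝ × ℝ) × ℝ) r := by
    intro p hp s hs
    rw [mem_ball_zero_iff, Prod.norm_def]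
    exact max_lt (mem_ball_zero_iff.1 hp) hs
  refine ⟨Metric.ball 0 r, Metric.ball_mem_nhds _ hr0, min r r₃, lt_min hr0 hr₃, ?_, ?_, ?_⟩
  · intro s hs hsδ
    refine Set.eq_empty_of_forall_notMem fun p hp => ?_
    have hs' : |s| < r := by
      rw [abs_of_pos hs]
      exact hsδ.trans_le (min_le_left _ _)
    exact h₁ (p, s) (Metric.ball_subset_ball (min_le_left _ _) (hmem p hp.2 s hs')) hs hp.1
  · intro t ht
    have htr : |t| < r := ht.trans_le (min_le_left _ _)
    have hsmall : ∀ t' : ℝ, |t'| = |t| → (u t', (0 : ℝ)) ∈ Metric.ball (0 : ℝ × ℝ) r := by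
      intro t' ht'
      have h := (h₃ t' (by
        rw [mem_ball_zero_iff, Real.norm_eq_abs, ht']
        exact ht.trans_le (min_le_right _ _))).2
      rw [mem_ball_zero_iff, Prod.norm_def]
      exact max_lt (mem_ball_zero_iff.1 h) (by simpa using hr0)
    have hiff : ∀ p ∈ Metric.ball (0 : ℝ × ℝ) r, p ∈ nonEdgeSingularSet (N.map (-t ^ 2)) ↔
        p.2 = 0 ∧ (p.1 = u t ∨ p.1 = u (-t)) := fun p hp =>
      h₂ (p, t) (Metric.ball_subset_ball (min_le_right _ _) (hmem p hp t htr))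
    ext p
    simp only [Set.mem_inter_iff, Set.mem_insert_iff, Set.mem_singleton_iff]
    constructor
    · rintro ⟨hp, hpU⟩
      obtain ⟨h0, h | h⟩ := (hiff p hpU).1 hp
      · exact Or.inl (Prod.ext h h0)
      · exact Or.inr (Prod.ext h h0)
    · rintro (rfl | rfl)
      · have hU := hsmall t rfl
        exact ⟨(hiff _ hU).2 ⟨rfl, Or.inl rfl⟩, hU⟩
      · have hU := hsmall (-t) (abs_neg t)
        exact ⟨(hiff _ hU).2 ⟨rfl, Or.inr rfl⟩, hU⟩
  · intro t ht ht0
    have htr : |t| < r₃ := ht.trans_le (min_le_right _ _)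
    obtain ⟨e1, e2, e3⟩ := (h₃ t (by simpa using htr)).1 ht0
    have e4 := ((h₃ (-t) (by simpa using htr)).1 (neg_ne_zero.2 ht0)).2.2
    rw [neg_sq] at e4
    exact ⟨e1, e2, e3, e4⟩
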